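/- Write $dP(x)=(1+x^2)^{-1}dx$ on $\mathbb{R}$. A weight is a measurable function $W:\mathbb{R}\to[0,\infty)$. It decays rapidly if $W(x)|x|^n\to 0$ as $|x|\to\infty$ for every $n=0,1,2,\dots$. Let $C_0(W)$ be the space of continuous $f:\mathbb{R}\to\mathbb{C}$ with $W(x)f(x)\to 0$ as $|x|\to\infty$, normed by $\|f\|_{C_0(W)}=\sup_x W(x)|f(x)|$. Let $M(W)$ be the space of complex Borel measures $\mu$ on $\mathbb{R}$ with $\int W^{-1}\,d|\mu|<\infty$ (where $W^{-1}=\infty$ if $W=0$). Write $m_n(\mu)=\int x^n\,d\mu(x)$. (a) Let $W$ be an even, bounded, rapidly decaying weight which is positive almost everywhere, whose logarithm is locally integrable, and such that for some $c>0$ $$W(x)=\exp\Big(-\int_c^{|x|}\frac{w(t)}{t}\,dt\Big),\qquad |x|\ge c,$$ where $w$ is a positive non-decreasing function on $[c,\infty)$ with $w(t)\to\infty$ as $t\to\infty$. Then the polynomials are dense in $C_0(W)$ if and only if $$\int_{\mathbb{R}}\frac{\log W(x)}{1+x^2}\,dx=-\infty .$$ Moreover, there is a nonzero $\mu\in M(W)$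 with $m_n(\mu)=0$ for all $n=0,1,2,\dots$ if and only if $\log W\in L^1(dP)$. (b) Let $W\in L^1(\mathbb{R})$ be any weight with $\log W\in L^1(dP)$. Then there is a nonzero $\mu\in M(W)$ all of whose moments exist as absolutely convergent integrals and satisfy $m_n(\mu)=0$, $n=0,1,2,\dots$. If in addition $W$ is bounded and decays rapidly, then the polynomials are not dense in $C_0(W)$. -/

import Mathlib

open MeasureTheory Filter Topology Set
open scoped ENNReal Polynomial

noncomputable section

namespace Bernstein

/-- The Poisson measure `dP(x) = (1 + x²)⁻¹ dx` on the real line. -/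
def poissonMeasure : Measure ℝ :=
  volume.withDensity fun x => ENNReal.ofReal (1 + x ^ 2)⁻¹

/-- `log W ∈ L¹(dP)`. Since `log 0 = -∞`, this includes that `W` is positive almost everywhere. -/
def LogIntegrable (W : ℝ → ℝ) : Prop :=
  (∀ᵐ x : ℝ, 0 < W x) ∧ Integrable (fun x => Real.log (W x)) poissonMeasure

/-- `∫ log W dP = -∞`: the positive part of the extended-real-valued function `log W` has finite
integral and its negative part has infinite integral. -/
def LogIntegralEqBot (W : ℝ → ℝ) : Prop :=
  (∫⁻ x, (ENNReal.log (ENNReal.ofReal (W x))).toENNReal ∂poissonMeasure) < ⊤ ∧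
    (∫⁻ x, (-ENNReal.log (ENNReal.ofReal (W x))).toENNReal ∂poissonMeasure) = ⊤

/-- `W` decays rapidly at infinity: `W(x) |x|ⁿ → 0` as `|x| → ∞`, for every `n ≥ 0`. -/
def RapidlyDecaying (W : ℝ → ℝ) : Prop :=
  ∀ n : ℕ, Tendsto (fun x : ℝ => W x * |x| ^ n) (cocompact ℝ) (𝓝 0)

/-- The space `C₀(W)` of continuous functions `f` with `W(x) f(x) → 0` as `|x| → ∞`. -/
def C0 (W : ℝ → ℝ) : Set (ℝ → ℂ) :=
  {f | Continuous f ∧ Tendsto (fun x => (W x : ℂ) * f x) (cocompact ℝ) (𝓝 0)}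

/-- `‖f‖ = sup_x W(x) |f(x)|`, with values in `[0, ∞]`. -/
def C0Norm (W : ℝ → ℝ) (f : ℝ → ℂ) : ℝ≥0∞ :=
  ⨆ x : ℝ, ENNReal.ofReal (W x) * ‖f x‖ₑ

/-- The polynomials lie in `C₀(W)` and are dense there:
`inf_p ‖f - p‖ = 0` for every `f ∈ C₀(W)`. -/
def PolynomialsDense (W : ℝ → ℝ) : Prop :=
  (∀ p : ℂ[X], (fun x : ℝ => p.eval (x : ℂ)) ∈ C0 W ∧
      C0Norm W (fun x : ℝ => p.eval (x : ℂ)) < ⊤) ∧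
    ∀ f ∈ C0 W, ⨅ p : ℂ[X], C0Norm W (fun x : ℝ => f x - p.eval (x : ℂ)) = 0

/-- `μ ∈ M(W)`: the integral of `W⁻¹` against the total variation measure `|μ|` is finite
(with `W⁻¹ = ∞` where `W = 0`). For bounded `W` every locally finite complex measure with
this property is finite. -/
def MemM (W : ℝ → ℝ) (μ : ComplexMeasure ℝ) : Prop :=
  (∫⁻ x, (ENNReal.ofReal (W x))⁻¹ ∂μ.variation) < ⊤

/-- All moments `mₙ(μ) = ∫ xⁿ dμ(x)`, `n = 0, 1, 2, …`, exist as absolutely convergent integrals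
and are equal to zero. -/
def MomentsVanish (μ : ComplexMeasure ℝ) : Prop :=
  ∀ n : ℕ, μ.Integrable (fun x : ℝ => (x : ℂ) ^ n) ∧
    VectorMeasure.integral μ (fun x : ℝ => (x : ℂ) ^ n) (ContinuousLinearMap.mul ℝ ℂ) = 0

/-- `W(x) = exp(-∫_c^{|x|} w(t)/t dt)` for `|x| ≥ c`, where `c > 0` and `w` is a positive
non-decreasing function on `[c, ∞)` tending to `∞`. -/
def HasRegularTail (W : ℝ → ℝ) : Prop :=
  ∃ (c : ℝ) (w : ℝ → ℝ), 0 < c ∧ (∀ t, c ≤ t → 0 < w t) ∧ MonotoneOn w (Ici c) ∧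
    Tendsto w atTop atTop ∧
    ∀ x : ℝ, c ≤ |x| → W x = Real.exp (-∫ t in c..|x|, w t / t)

/-- An even, rapidly decaying weight with a regular tail; on compact sets it is only asked to be
bounded and to have integrable logarithm. -/
structure IsRegularWeight (W : ℝ → ℝ) : Prop where
  measurable : Measurable W
  nonneg : ∀ x, 0 ≤ W x
  bounded : ∃ M : ℝ, ∀ x, W x ≤ M
  ae_pos : ∀ᵐ x : ℝ, 0 < W x
  log_locallyIntegrable : LocallyIntegrable (fun x => Real.log (W x)) volume
  even : ∀ x, W (-x) = W x
  rapidlyDecaying : RapidlyDecaying W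
  regularTail : HasRegularTail W

end Bernstein

end

open scoped BoundedContinuousFunction

namespace Bernstein

/-! The engine is Jensen's inequality `π log |q(i)| ≤ ∫ log |q| dP` for polynomials `q` with `q(i) ≠
0`. If `log W` is `P`-integrable, a polynomial `p` very close to `(x - i)⁻¹` in `C₀(W)` would make
`q = 1 - (X - i) p`, which is `1` at `i`, too small on the line for this inequality
(`not_polynomialsDense`). The same obstruction in a weighted `L²` space leaves a nonzero function
orthogonal to all polynomials, and its product with the weight is the density of an annihilating
measure (`exists_annihilating_of_logIntegrable`).

For the converse, replace `W` by a continuous weight `G = exp(-k(|x|))` with the same tail. Suppose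
a functional `L` kills every `G p` but not `G / (x - i)`. Polynomial division gives `L(G p / (x -
z)) = p(z) L(G / (x - z))`. With `p = X ^ n` and `n` adapted to `|z|`, which the regular tail
permits, `L(G / (x - z))` is forced to decay essentially like `G(|z|)`. Jensen's inequality in a
disc tangent at the point at infinity then bounds `∫ k(|x|) dP`, against the divergence hypothesis
(`resolvent_I_mul_mem_polyClosure`). Hence `G / (x - i)` is a limit of weighted polynomials, and
Stone–Weierstrass upgrades this to density.

Density forces every measure in `M(W)` with vanishing moments to be zero
(`eq_zero_of_polynomialsDense`). A bounded weight that is positive almost everywhere has either an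
integrable logarithm or logarithmic integral `-∞`, so these implications close both equivalences. -/

/-! ### Jensen's inequality for polynomials against the Poisson measure -/

/-- Subharmonicity of `log ‖f‖` at the centre of a circle. -/
theorem log_norm_le_circleAverage {f : ℂ → ℂ} {R : ℝ} (hR : 0 < R)
    (hf : AnalyticOnNhd ℂ f (Metric.closedBall 0 R)) (h0 : f 0 ≠ 0) :
    Real.log ‖f 0‖ ≤ Real.circleAverage (fun z => Real.log ‖f z‖) 0 R := by
  have hf' : AnalyticOnNhd ℂ f (Metric.closedBall 0 |R|) := by rwa [abs_of_pos hR]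
  rw [hf'.circleAverage_log_norm hR.ne' h0, le_add_iff_nonneg_left]
  refine finsum_nonneg fun u => ?_
  by_cases hu : u ∈ Metric.closedBall (0 : ℂ) |R|
  · refine mul_nonneg (mod_cast MeromorphicOn.AnalyticOnNhd.divisor_nonneg hf' u) ?_
    rcases eq_or_ne u 0 with rfl | hu0
    · simp
    · refine Real.log_nonneg ?_
      rw [zero_sub, norm_neg, ← div_eq_mul_inv, one_le_div (norm_pos_iff.2 hu0)]
      simpa [abs_of_pos hR] using hu
  · simp [hu]

theorem measurable_poissonDensity :
    Measurable fun x : ℝ => ENNReal.ofReal (1 + x ^ 2)⁻¹ := by fun_prop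

theorem lintegral_poissonMeasure {f : ℝ → ℝ≥0∞} (hf : AEMeasurable f) :
    ∫⁻ x, f x ∂poissonMeasure = ∫⁻ x, ENNReal.ofReal (1 + x ^ 2)⁻¹ * f x :=
  lintegral_withDensity_eq_lintegral_mul₀ measurable_poissonDensity.aemeasurable hf

theorem integrable_poissonMeasure_iff {g : ℝ → ℝ} :
    Integrable g poissonMeasure ↔ Integrable fun x => (1 + x ^ 2)⁻¹ * g x := by
  rw [poissonMeasure, integrable_withDensity_iff_integrable_smul' measurable_poissonDensity
    (by simp)]
  have h : ∀ x : ℝ, (ENNReal.ofReal (1 + x ^ 2)⁻¹).toReal = (1 + x ^ 2)⁻¹ := fun x =>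
    ENNReal.toReal_ofReal (by positivity)
  simp_rw [h, smul_eq_mul]

theorem integral_poissonMeasure (g : ℝ → ℝ) :
    ∫ x, g x ∂poissonMeasure = ∫ x, (1 + x ^ 2)⁻¹ * g x := by
  rw [poissonMeasure, integral_withDensity_eq_integral_toReal_smul measurable_poissonDensity
    (by simp)]
  have h : ∀ x : ℝ, (ENNReal.ofReal (1 + x ^ 2)⁻¹).toReal = (1 + x ^ 2)⁻¹ := fun x =>
    ENNReal.toReal_ofReal (by positivity)
  simp_rw [h, smul_eq_mul]

theorem integral_const_poissonMeasure (c : ℝ) : ∫ _, c ∂poissonMeasure = Real.pi * c := by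
  rw [integral_poissonMeasure, integral_mul_const, integral_univ_inv_one_add_sq]

instance : IsFiniteMeasure poissonMeasure := by
  have h : Integrable (fun _ : ℝ => (1 : ℝ)) poissonMeasure :=
    integrable_poissonMeasure_iff.2 (by simpa using integrable_inv_one_add_sq)
  exact (integrable_const_iff_isFiniteMeasure one_ne_zero).1 h

theorem poissonMeasure_absolutelyContinuous : poissonMeasure ≪ volume :=
  withDensity_absolutelyContinuous _ _

/-- The point `(1 + ix) / (1 - ix)` of the unit circle. -/
noncomputable def cayley (x : ℝ) : ℂ := circleMap 0 1 (2 * Real.arctan x)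

theorem one_add_cayley (x : ℝ) :
    1 + cayley x = 2 * Real.cos (Real.arctan x) * Complex.exp (Real.arctan x * Complex.I) := by
  have h : cayley x = Complex.exp (Real.arctan x * Complex.I) ^ 2 := by
    simp only [cayley, circleMap, ← Complex.exp_nat_mul]
    push_cast
    ring_nf
  rw [h, Complex.ofReal_cos, Complex.cos, neg_mul, Complex.exp_neg]
  field_simp [Complex.exp_ne_zero]
  ring

/-- This is the inverse Cayley map `x = i(1 - ζ)/(1 + ζ)` with denominators cleared. -/
theorem I_mul_one_sub_cayley (x : ℝ) :
    Complex.I * (1 - cayley x) = x * (1 + cayley x) := by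
  have h : cayley x = Complex.exp (Real.arctan x * Complex.I) ^ 2 := by
    simp only [cayley, circleMap, ← Complex.exp_nat_mul]
    push_cast
    ring_nf
  have hs : Complex.I * (1 - cayley x) =
      2 * Real.sin (Real.arctan x) * Complex.exp (Real.arctan x * Complex.I) := by
    rw [h, Complex.ofReal_sin, Complex.sin, neg_mul, Complex.exp_neg]
    field_simp [Complex.exp_ne_zero]
  have ht : Real.sin (Real.arctan x) = x * Real.cos (Real.arctan x) := by
    rw [Real.sin_arctan, Real.cos_arctan]; ring
  rw [hs, one_add_cayley, ht]
  push_cast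
  ring

theorem one_add_cayley_ne_zero (x : ℝ) : 1 + cayley x ≠ 0 := by
  rw [one_add_cayley]
  exact mul_ne_zero (mul_ne_zero two_ne_zero
    (Complex.ofReal_ne_zero.2 (Real.cos_arctan_pos x).ne')) (Complex.exp_ne_zero _)

/-- The substitution `θ = 2 arctan x` turns `dθ` into `2 dP`; periodicity moves the circle integral
to `(-π, π)`, the range of `2 arctan`. -/
theorem integrable_comp_cayley {v : ℂ → ℝ} (hv : CircleIntegrable v 0 1) :
    Integrable (fun x => v (cayley x)) poissonMeasure := by
  have hper : Function.Periodic (fun θ => v (circleMap 0 1 θ)) (2 * Real.pi) := fun θ => by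
    simp only [periodic_circleMap 0 1 θ]
  have h1 : IntervalIntegrable (fun θ => v (circleMap 0 1 θ)) volume (-Real.pi) Real.pi :=
    hper.intervalIntegrable (t := 0) Real.two_pi_pos.ne' (by rw [zero_add]; exact hv) _ _
  have h2 := h1.comp_mul_left (c := 2)
  rw [intervalIntegrable_iff_integrableOn_Ioo_of_le (by linarith [Real.pi_pos]),
    show -Real.pi / 2 = -(Real.pi / 2) by ring, ← Real.range_arctan, ← image_univ,
    integrableOn_image_iff_integrableOn_abs_deriv_smul MeasurableSet.univ
      (fun x _ => (Real.hasDerivAt_arctan x).hasDerivWithinAt) Real.arctan_injective.injOn,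
    integrableOn_univ] at h2
  refine integrable_poissonMeasure_iff.2 (h2.congr (ae_of_all _ fun x => ?_))
  have : (0 : ℝ) ≤ (1 + x ^ 2)⁻¹ := by positivity
  simp only [one_div, abs_of_nonneg this, smul_eq_mul, cayley]

theorem integral_comp_cayley (v : ℂ → ℝ) :
    ∫ x, v (cayley x) ∂poissonMeasure = Real.pi * Real.circleAverage v 0 1 := by
  have hper : Function.Periodic (fun θ => v (circleMap 0 1 θ)) (2 * Real.pi) := fun θ => by
    simp only [periodic_circleMap 0 1 θ]
  have h1 : ∫ θ in (0 : ℝ)..2 * Real.pi, v (circleMap 0 1 θ) =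
      2 * ∫ y in Ioo (-(Real.pi / 2)) (Real.pi / 2), v (circleMap 0 1 (2 * y)) := by
    have := hper.intervalIntegral_add_eq 0 (-Real.pi)
    rw [zero_add, show -Real.pi + 2 * Real.pi = Real.pi by ring] at this
    rw [this, ← integral_Ioc_eq_integral_Ioo,
      ← intervalIntegral.integral_of_le (by linarith [Real.pi_pos]),
      intervalIntegral.mul_integral_comp_mul_left (f := fun θ => v (circleMap 0 1 θ))]
    congr 1 <;> ring
  have h2 : ∫ y in Ioo (-(Real.pi / 2)) (Real.pi / 2), v (circleMap 0 1 (2 * y)) =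
      ∫ x, v (cayley x) ∂poissonMeasure := by
    rw [← Real.range_arctan, ← image_univ,
      integral_image_eq_integral_abs_deriv_smul MeasurableSet.univ
      (fun x _ => (Real.hasDerivAt_arctan x).hasDerivWithinAt) Real.arctan_injective.injOn,
      Measure.restrict_univ, integral_poissonMeasure]
    refine integral_congr_ae (ae_of_all _ fun x => ?_)
    have : (0 : ℝ) ≤ (1 + x ^ 2)⁻¹ := by positivity
    simp only [one_div, abs_of_nonneg this, smul_eq_mul, cayley]
  rw [Real.circleAverage, h1, h2, smul_eq_mul]
  have := Real.pi_pos.ne'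
  field_simp

/-- On the circle `x - a = f(ζ)/g(ζ)` with `f`, `g` affine and `f(0) = i - a`. The mean of `log |1 +
ζ|` is zero, so Jensen's inequality for `f` at the origin is the whole estimate. -/
theorem log_norm_sub_integrable_and_le {a : ℂ} (ha : a ≠ Complex.I) :
    Integrable (fun x : ℝ => Real.log ‖(x : ℂ) - a‖) poissonMeasure ∧
      Real.pi * Real.log ‖Complex.I - a‖ ≤
        ∫ x : ℝ, Real.log ‖(x : ℂ) - a‖ ∂poissonMeasure := by
  set f : ℂ → ℂ := fun z => (Complex.I - a) - (Complex.I + a) * z with hf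
  set g : ℂ → ℂ := fun z => z + 1 with hg
  have hfm : CircleIntegrable (fun z => Real.log ‖f z‖) 0 1 :=
    MeromorphicOn.circleIntegrable_log_norm fun z _ => by fun_prop
  have hgm : CircleIntegrable (fun z => Real.log ‖g z‖) 0 1 :=
    MeromorphicOn.circleIntegrable_log_norm fun z _ => by fun_prop
  have key : (fun x : ℝ => Real.log ‖(x : ℂ) - a‖) =ᵐ[poissonMeasure]
      fun x => Real.log ‖f (cayley x)‖ - Real.log ‖g (cayley x)‖ := by
    have hne : ∀ᵐ x : ℝ ∂poissonMeasure, x ≠ a.re :=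
      poissonMeasure_absolutelyContinuous.ae_le ((countable_singleton a.re).ae_notMem volume)
    filter_upwards [hne] with x hx
    have h1 : g (cayley x) ≠ 0 := by
      rw [hg]; simpa [add_comm] using one_add_cayley_ne_zero x
    have h2 : f (cayley x) = (x - a) * g (cayley x) := by
      simp only [hf, hg]
      linear_combination I_mul_one_sub_cayley x
    have h3 : (x : ℂ) - a ≠ 0 := fun h => hx (by simpa using congrArg Complex.re (sub_eq_zero.1 h))
    rw [h2, norm_mul, Real.log_mul (norm_ne_zero_iff.2 h3) (norm_ne_zero_iff.2 h1)]
    ring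
  have hif := integrable_comp_cayley hfm
  have hig := integrable_comp_cayley hgm
  refine ⟨(hif.sub hig).congr key.symm, ?_⟩
  rw [integral_congr_ae key, integral_sub hif hig,
    integral_comp_cayley fun z => Real.log ‖f z‖, integral_comp_cayley fun z => Real.log ‖g z‖,
    circleAverage_log_norm_add_const_eq_posLog]
  have h0 : f 0 ≠ 0 := by simpa [hf, sub_eq_zero] using ha.symm
  have := log_norm_le_circleAverage one_pos (f := f) (fun z _ => by fun_prop) h0
  simp only [hf, mul_zero, sub_zero] at this
  simpa using mul_le_mul_of_nonneg_left this Real.pi_pos.le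

theorem ae_eval_ne_zero {q : ℂ[X]} (hq : q ≠ 0) : ∀ᵐ x : ℝ, q.eval (x : ℂ) ≠ 0 := by
  have hfin : {x : ℝ | q.eval (x : ℂ) = 0}.Finite :=
    (q.roots.toFinset.finite_toSet.preimage Complex.ofReal_injective.injOn).subset fun x hx => by
      simpa [Polynomial.mem_roots hq] using hx
  exact hfin.countable.ae_notMem volume

/-- Jensen's inequality for a polynomial in the upper half-plane. -/
theorem log_norm_eval_integrable_and_le (q : ℂ[X]) (hq : q.eval Complex.I ≠ 0) :
    Integrable (fun x : ℝ => Real.log ‖q.eval (x : ℂ)‖) poissonMeasure ∧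
      Real.pi * Real.log ‖q.eval Complex.I‖ ≤
        ∫ x : ℝ, Real.log ‖q.eval (x : ℂ)‖ ∂poissonMeasure := by
  induction hn : q.natDegree generalizing q with
  | zero =>
    obtain ⟨c, rfl⟩ : ∃ c, q = Polynomial.C c := ⟨_, Polynomial.eq_C_of_natDegree_eq_zero hn⟩
    simp only [Polynomial.eval_C, integral_const_poissonMeasure, le_refl, and_true]
    exact integrable_const _
  | succ n ih =>
    obtain ⟨a, hroot⟩ := IsAlgClosed.exists_root q
      (by rw [Polynomial.degree_eq_natDegree (by rintro rfl; simp at hq), hn]; norm_cast)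
    obtain ⟨r, rfl⟩ := Polynomial.dvd_iff_isRoot.2 hroot
    have hr0 : r ≠ 0 := by rintro rfl; simp at hq
    rw [Polynomial.natDegree_mul (Polynomial.X_sub_C_ne_zero a) hr0,
      Polynomial.natDegree_X_sub_C] at hn
    simp only [Polynomial.eval_mul, Polynomial.eval_sub, Polynomial.eval_X, Polynomial.eval_C,
      ne_eq, mul_eq_zero, not_or] at hq ⊢
    obtain ⟨hi, hle⟩ := ih r hq.2 (by omega)
    obtain ⟨hi', hle'⟩ := log_norm_sub_integrable_and_le (a := a)
      (fun h => hq.1 (by rw [h, sub_self]))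
    have key : (fun x : ℝ => Real.log ‖((x : ℂ) - a) * r.eval (x : ℂ)‖) =ᵐ[poissonMeasure]
        fun x => Real.log ‖(x : ℂ) - a‖ + Real.log ‖r.eval (x : ℂ)‖ := by
      have hae := poissonMeasure_absolutelyContinuous.ae_le
        (ae_eval_ne_zero (mul_ne_zero (Polynomial.X_sub_C_ne_zero a) hr0))
      filter_upwards [hae] with x hx
      simp only [Polynomial.eval_mul, Polynomial.eval_sub, Polynomial.eval_X, Polynomial.eval_C,
        ne_eq, mul_eq_zero, not_or] at hx
      rw [norm_mul, Real.log_mul (norm_ne_zero_iff.2 hx.1) (norm_ne_zero_iff.2 hx.2)]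
    refine ⟨(hi'.add hi).congr key.symm, ?_⟩
    rw [integral_congr_ae key, integral_add hi' hi, norm_mul,
      Real.log_mul (norm_ne_zero_iff.2 hq.1) (norm_ne_zero_iff.2 hq.2), mul_add]
    exact add_le_add hle' hle

/-- A polynomial equal to `1` at `i` cannot have a majorant with negative logarithmic integral. -/
theorem integral_nonneg_of_log_norm_eval_le {q : ℂ[X]} (hq : q.eval Complex.I = 1) {v : ℝ → ℝ}
    (hv : Integrable v poissonMeasure)
    (hle : ∀ᵐ x : ℝ, q.eval (x : ℂ) ≠ 0 → Real.log ‖q.eval (x : ℂ)‖ ≤ v x) :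
    0 ≤ ∫ x, v x ∂poissonMeasure := by
  obtain ⟨hi, h⟩ := log_norm_eval_integrable_and_le q (by simp [hq])
  rw [hq, norm_one, Real.log_one, mul_zero] at h
  refine h.trans (integral_mono_ae hi hv ?_)
  have hq0 : q ≠ 0 := by rintro rfl; simp at hq
  refine poissonMeasure_absolutelyContinuous.ae_le ?_
  filter_upwards [hle, ae_eval_ne_zero hq0] with x h1 h2 using h1 h2

/-! ### Convergent logarithmic integral: polynomials are not dense -/

theorem norm_ofReal_sub_I_sq (x : ℝ) : ‖(x : ℂ) - Complex.I‖ ^ 2 = 1 + x ^ 2 := by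
  rw [← Complex.normSq_eq_norm_sq, Complex.normSq_apply]
  simp
  ring

theorem ofReal_sub_I_ne_zero (x : ℝ) : (x : ℂ) - Complex.I ≠ 0 := by
  intro h
  have := norm_ofReal_sub_I_sq x
  rw [h] at this
  norm_num at this
  nlinarith [sq_nonneg x]

theorem norm_inv_ofReal_sub_I_le (x : ℝ) : ‖((x : ℂ) - Complex.I)⁻¹‖ ≤ 1 := by
  rw [norm_inv]
  refine inv_le_one_of_one_le₀ ?_
  nlinarith [norm_ofReal_sub_I_sq x, norm_nonneg ((x : ℂ) - Complex.I), sq_nonneg x]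

theorem continuous_inv_ofReal_sub_I : Continuous fun x : ℝ => ((x : ℂ) - Complex.I)⁻¹ :=
  (by fun_prop : Continuous fun x : ℝ => (x : ℂ) - Complex.I).inv₀ ofReal_sub_I_ne_zero

/-- The estimate for linear factors excludes the root `i`, but `|x - i| = |x + i|` on the line. -/
theorem integrable_log_norm_ofReal_sub_I :
    Integrable (fun x : ℝ => Real.log ‖(x : ℂ) - Complex.I‖) poissonMeasure := by
  refine (log_norm_sub_integrable_and_le (a := -Complex.I) ?_).1.congr (ae_of_all _ fun x => ?_)
  · intro h
    have := congrArg Complex.im h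
    norm_num at this
  · have h : ‖(x : ℂ) - -Complex.I‖ = ‖(x : ℂ) - Complex.I‖ := by
      rw [← Complex.norm_conj]
      simp [sub_eq_add_neg]
    simp only [h]

/-- The polynomial `1 - (X - i) p`, which takes the value `1` at `i`. -/
noncomputable def remainder (p : ℂ[X]) : ℂ[X] := 1 - (Polynomial.X - Polynomial.C Complex.I) * p

theorem eval_I_remainder (p : ℂ[X]) : (remainder p).eval Complex.I = 1 := by
  simp [remainder]

theorem eval_remainder (p : ℂ[X]) (x : ℝ) :
    (remainder p).eval (x : ℂ) =
      ((x : ℂ) - Complex.I) * (((x : ℂ) - Complex.I)⁻¹ - p.eval (x : ℂ)) := by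
  simp only [remainder, Polynomial.eval_sub, Polynomial.eval_one, Polynomial.eval_mul,
    Polynomial.eval_X, Polynomial.eval_C, mul_sub, mul_inv_cancel₀ (ofReal_sub_I_ne_zero x)]

theorem exists_C0Norm_lt_of_polynomialsDense {W : ℝ → ℝ} (h : PolynomialsDense W) {f : ℝ → ℂ}
    (hf : f ∈ C0 W) {ε : ℝ≥0∞} (hε : 0 < ε) :
    ∃ p : ℂ[X], C0Norm W (fun x : ℝ => f x - p.eval (x : ℂ)) < ε :=
  iInf_lt_iff.1 ((h.2 f hf).trans_lt hε)

theorem not_polynomialsDense {W : ℝ → ℝ} (hW : ∀ x, 0 ≤ W x) (hlog : LogIntegrable W)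
    (hdecay : RapidlyDecaying W) : ¬ PolynomialsDense W := by
  intro hdense
  have hmem : (fun x : ℝ => ((x : ℂ) - Complex.I)⁻¹) ∈ C0 W := by
    refine ⟨continuous_inv_ofReal_sub_I, ?_⟩
    refine squeeze_zero_norm (fun x => ?_) (by simpa using hdecay 0)
    rw [norm_mul, Complex.norm_real, Real.norm_of_nonneg (hW x)]
    exact mul_le_of_le_one_right (hW x) (norm_inv_ofReal_sub_I_le x)
  set A := ∫ x : ℝ, Real.log ‖(x : ℂ) - Complex.I‖ ∂poissonMeasure
  set B := ∫ x : ℝ, Real.log (W x) ∂poissonMeasure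
  -- Chosen so that the majorant `log |x - i| + l - log W` has integral `A + π l - B = -1`.
  set l := (B - A - 1) / Real.pi with hl
  obtain ⟨p, hp⟩ := exists_C0Norm_lt_of_polynomialsDense hdense hmem
    (ε := ENNReal.ofReal (Real.exp l)) (ENNReal.ofReal_pos.2 (Real.exp_pos l))
  have hbound : ∀ x : ℝ, W x * ‖((x : ℂ) - Complex.I)⁻¹ - p.eval (x : ℂ)‖ ≤ Real.exp l := by
    intro x
    have h1 := (le_iSup (fun x : ℝ => ENNReal.ofReal (W x) *
      ‖((x : ℂ) - Complex.I)⁻¹ - p.eval (x : ℂ)‖ₑ) x).trans hp.le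
    rw [← ofReal_norm, ← ENNReal.ofReal_mul (hW x)] at h1
    exact (ENNReal.ofReal_le_ofReal_iff (Real.exp_pos l).le).1 h1
  have hsub : Integrable (fun x : ℝ => l - Real.log (W x)) poissonMeasure :=
    (integrable_const l).sub hlog.2
  have hint : Integrable (fun x : ℝ => Real.log ‖(x : ℂ) - Complex.I‖ + (l - Real.log (W x)))
      poissonMeasure :=
    integrable_log_norm_ofReal_sub_I.add hsub
  have hnonneg := integral_nonneg_of_log_norm_eval_le (eval_I_remainder p) hint (by
    filter_upwards [hlog.1] with x hx hq
    rw [eval_remainder] at hq ⊢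
    obtain ⟨h1, h2⟩ := mul_ne_zero_iff.1 hq
    have h2' := norm_pos_iff.2 h2
    rw [norm_mul, Real.log_mul (norm_ne_zero_iff.2 h1) h2'.ne']
    have := Real.log_le_log (mul_pos hx h2') (hbound x)
    rw [Real.log_exp, Real.log_mul hx.ne' h2'.ne'] at this
    linarith)
  rw [integral_add integrable_log_norm_ofReal_sub_I hsub,
    integral_sub (integrable_const l) hlog.2, integral_const_poissonMeasure, hl,
    mul_div_cancel₀ _ Real.pi_pos.ne'] at hnonneg
  linarith

/-! ### Convergent logarithmic integral: an annihilating measure -/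

/-- A slowly growing function dominating every logarithm, used to make a weight decay rapidly. -/
noncomputable def slow (x : ℝ) : ℝ := (1 + x ^ 2) ^ (1 / 4 : ℝ)

theorem slow_pos (x : ℝ) : 0 < slow x := Real.rpow_pos_of_pos (by positivity) _

theorem slow_pow_four (x : ℝ) : slow x ^ 4 = 1 + x ^ 2 := by
  rw [slow, ← Real.rpow_natCast, ← Real.rpow_mul (by positivity)]
  norm_num

theorem continuous_slow : Continuous slow :=
  (by fun_prop : Continuous fun x : ℝ => 1 + x ^ 2).rpow_const fun _ => Or.inr (by norm_num)

theorem integrable_slow : Integrable slow poissonMeasure := by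
  rw [integrable_poissonMeasure_iff]
  have h := integrable_rpow_neg_one_add_norm_sq (E := ℝ) (μ := volume) (r := 3 / 2)
    (by norm_num)
  refine h.congr (ae_of_all _ fun x => ?_)
  have hx : 0 < 1 + x ^ 2 := by positivity
  simp only [Real.norm_eq_abs, sq_abs, slow]
  rw [← Real.rpow_neg_one, ← Real.rpow_add hx]
  norm_num

/-- With `s = slow x`, both `|x| ≤ s²` and `1 + x² = s⁴`, so one term `s ^ (2n + 4) / (2n + 4)!` of
the exponential series gives domination by a multiple of `(1 + x²)⁻¹`. -/
theorem integrable_pow_mul_exp_neg_slow (n : ℕ) :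
    Integrable fun x : ℝ => |x| ^ n * Real.exp (-slow x) := by
  refine (integrable_inv_one_add_sq.const_mul ((2 * n + 4).factorial : ℝ)).mono'
    ((by fun_prop : Continuous fun x : ℝ => |x| ^ n).mul
      (Real.continuous_exp.comp continuous_slow.neg)).aestronglyMeasurable
    (ae_of_all _ fun x => ?_)
  have hs := slow_pos x
  have hx : 0 < 1 + x ^ 2 := by positivity
  rw [Real.norm_of_nonneg (by positivity), Real.exp_neg, ← div_eq_mul_inv, ← div_eq_mul_inv,
    div_le_div_iff₀ (Real.exp_pos _) hx]
  have h1 : |x| ≤ slow x ^ 2 := by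
    refine abs_le_of_sq_le_sq ?_ (by positivity)
    rw [← pow_mul, slow_pow_four]
    linarith
  have h2 := Real.pow_div_factorial_le_exp _ hs.le (2 * n + 4)
  rw [div_le_iff₀ (by positivity)] at h2
  calc |x| ^ n * (1 + x ^ 2) ≤ (slow x ^ 2) ^ n * slow x ^ 4 := by
        rw [slow_pow_four]; gcongr
    _ = slow x ^ (2 * n + 4) := by rw [← pow_mul, pow_add]
    _ ≤ _ := h2.trans_eq (mul_comm _ _)

/-- An `L²` form of the obstruction: with `q = remainder p`, the integrand times `1 + x²` is `y = ω
|q|²`, and a small `∫ y dP` makes `∫ log |q| dP` negative. -/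
theorem exists_log_integral_lower_bound {ω : ℝ → ℝ} (hpos : ∀ᵐ x, 0 < ω x)
    (hlog : Integrable (fun x => Real.log (ω x)) poissonMeasure) :
    ∃ δ : ℝ, 0 < δ ∧ ∀ p : ℂ[X],
      Integrable (fun x : ℝ => ω x * ‖((x : ℂ) - Complex.I)⁻¹ - p.eval (x : ℂ)‖ ^ 2) →
      δ < ∫ x : ℝ, ω x * ‖((x : ℂ) - Complex.I)⁻¹ - p.eval (x : ℂ)‖ ^ 2 := by
  set A := ∫ x : ℝ, Real.log (ω x) ∂poissonMeasure
  set l := (A - 2) / Real.pi with hl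
  refine ⟨Real.exp l, Real.exp_pos l, fun p hp => ?_⟩
  by_contra! hle
  set e : ℝ → ℝ := fun x => ω x * ‖((x : ℂ) - Complex.I)⁻¹ - p.eval (x : ℂ)‖ ^ 2 with he
  set y : ℝ → ℝ := fun x => (1 + x ^ 2) * e x with hy
  have hye : ∀ x, (1 + x ^ 2)⁻¹ * y x = e x := fun x => by
    have : (1 + x ^ 2) ≠ 0 := by positivity
    simp only [hy]
    field_simp
  have hyi : Integrable y poissonMeasure := by
    rw [integrable_poissonMeasure_iff]
    simpa only [hye] using hp
  have hyint : ∫ x, y x ∂poissonMeasure = ∫ x, e x := by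
    rw [integral_poissonMeasure]
    simp only [hye]
  have hadd : Integrable (fun x => l + y x / Real.exp l) poissonMeasure :=
    (integrable_const l).add (hyi.div_const _)
  have hint : Integrable (fun x => (1 / 2 : ℝ) * (l + y x / Real.exp l - Real.log (ω x)))
      poissonMeasure :=
    (hadd.sub hlog).const_mul _
  have hnonneg := integral_nonneg_of_log_norm_eval_le (eval_I_remainder p) hint (by
    filter_upwards [hpos] with x hx hq
    have hsq : ‖(remainder p).eval (x : ℂ)‖ ^ 2 * ω x = y x := by
      rw [eval_remainder, norm_mul, mul_pow, norm_ofReal_sub_I_sq]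
      simp only [hy, he]
      ring
    have hq' := norm_pos_iff.2 hq
    have hy0 : 0 < y x := by rw [← hsq]; positivity
    -- The tangent line of `log` at `exp l` bounds `log y` linearly in `y`. With `π l = A - 2`, the
    -- resulting majorant of `log |q|` has integral at most `-1/2`.
    have h1 := Real.log_le_sub_one_of_pos (div_pos hy0 (Real.exp_pos l))
    rw [Real.log_div hy0.ne' (Real.exp_pos l).ne', Real.log_exp, ← hsq,
      Real.log_mul (by positivity) hx.ne', Real.log_pow] at h1
    rw [hsq] at h1
    push_cast at h1
    linarith)
  rw [integral_const_mul, integral_sub hadd hlog,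
    integral_add (integrable_const l) (hyi.div_const _), integral_const_poissonMeasure,
    integral_div, hyint, hl, mul_div_cancel₀ _ Real.pi_pos.ne'] at hnonneg
  have : (∫ x, e x) / Real.exp ((A - 2) / Real.pi) ≤ 1 :=
    (div_le_one (Real.exp_pos _)).2 hle
  linarith

/-- Integration against the complex measure with density `h`. -/
theorem integral_withDensityᵥ {α : Type*} [MeasurableSpace α] {ν : Measure α} {h : α → ℂ}
    (hh : Integrable h ν) {f : α → ℂ} (hf : (ν.withDensityᵥ h).Integrable f) :
    VectorMeasure.integral (ν.withDensityᵥ h) f (ContinuousLinearMap.mul ℝ ℂ) =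
      ∫ x, f x * h x ∂ν := by
  have hvar := Measure.variation_withDensityᵥ hh
  have hfin : IsFiniteMeasure (ν.withDensityᵥ h).variation := by
    rw [hvar]; exact isFiniteMeasure_withDensity hh.2.ne
  have hmul : ∀ {g : α → ℂ}, Integrable g (ν.withDensityᵥ h).variation →
      Integrable (fun x => g x * h x) ν := by
    intro g hg
    rw [hvar, integrable_withDensity_iff_integrable_smul₀' hh.1.enorm (by simp)] at hg
    have h1 : AEStronglyMeasurable (fun x => g x * h x) ν := by
      -- Only `‖h‖ g` is known to be measurable; multiplying by the phase `h / ‖h‖` recovers `g h`,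
      -- also where `h = 0`.
      have hm := hg.1.mul (hh.1.norm.inv₀.smul hh.1)
      refine hm.congr (ae_of_all _ fun x => ?_)
      rcases eq_or_ne (h x) 0 with h0 | h0
      · simp [h0]
      · have : (‖h x‖ : ℂ) ≠ 0 := by simpa using h0
        simp only [Pi.mul_apply, Pi.smul_apply', Pi.inv_apply, toReal_enorm, Complex.real_smul,
          Complex.ofReal_inv]
        field_simp
    refine (integrable_norm_iff h1).1 (hg.norm.congr (ae_of_all _ fun x => ?_))
    simp [mul_comm]
  refine Integrable.induction (μ := (ν.withDensityᵥ h).variation)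
    (P := fun f => VectorMeasure.integral (ν.withDensityᵥ h) f (ContinuousLinearMap.mul ℝ ℂ) =
      ∫ x, f x * h x ∂ν) ?_ ?_ ?_ ?_ hf
  · intro c s hs _
    rw [VectorMeasure.integral_indicator_const c hs, withDensityᵥ_apply hh hs,
      ContinuousLinearMap.mul_apply', ← integral_const_mul, ← integral_indicator hs]
    refine integral_congr_ae (ae_of_all _ fun x => ?_)
    by_cases hx : x ∈ s <;> simp [hx]
  · intro f g _ hf hg h1 h2
    rw [VectorMeasure.integral_add hf hg, h1, h2, ← integral_add (hmul hf) (hmul hg)]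
    simp only [Pi.add_apply, add_mul]
  · refine isClosed_eq VectorMeasure.continuous_integral ?_
    refine LipschitzWith.continuous (K := 1) (LipschitzWith.of_dist_le_mul fun f g => ?_)
    rw [dist_eq_norm, ← integral_sub (hmul (L1.integrable_coeFn f)) (hmul (L1.integrable_coeFn g)),
      NNReal.coe_one, one_mul, dist_eq_norm, L1.norm_eq_integral_norm]
    refine (norm_integral_le_integral_norm _).trans_eq ?_
    have h1 : ∫ x, ‖(f - g : α →₁[(ν.withDensityᵥ h).variation] ℂ) x‖
        ∂(ν.withDensityᵥ h).variation = ∫ x, ‖f x - g x‖ ∂(ν.withDensityᵥ h).variation :=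
      integral_congr_ae ((Lp.coeFn_sub f g).fun_comp norm)
    have h2 : ∀ F : α → ℝ, ∫ x, F x ∂(ν.withDensityᵥ h).variation = ∫ x, ‖h x‖ * F x ∂ν := by
      intro F
      rw [hvar, integral_withDensity_eq_integral_toReal_smul₀ hh.1.enorm (by simp)]
      simp only [toReal_enorm, smul_eq_mul]
    rw [h1, h2]
    refine integral_congr_ae (ae_of_all _ fun x => ?_)
    simp only [← sub_mul, norm_mul]
    rw [mul_comm]
  · intro f g hfg hf h1
    rw [← VectorMeasure.integral_congr_ae hfg, h1]
    rw [hvar] at hfg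
    refine integral_congr_ae ?_
    have := (ae_withDensity_iff' hh.1.enorm).1 hfg
    filter_upwards [this] with x hx
    by_cases h0 : h x = 0
    · simp [h0]
    · rw [hx (by simpa using h0)]

/-- The weight `min(W, 1)² exp(-(1 + x²)^{1/4})`. -/
noncomputable def tame (W : ℝ → ℝ) (x : ℝ) : ℝ := min (W x) 1 ^ 2 * Real.exp (-slow x)

theorem tame_nonneg (W : ℝ → ℝ) (x : ℝ) : 0 ≤ tame W x := by
  unfold tame; positivity

theorem tame_le {W : ℝ → ℝ} {x : ℝ} (hW : 0 ≤ W x) : tame W x ≤ Real.exp (-slow x) :=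
  mul_le_of_le_one_left (Real.exp_pos _).le
    (pow_le_one₀ (le_min hW zero_le_one) (min_le_right _ _))

theorem measurable_tame {W : ℝ → ℝ} (hW : Measurable W) : Measurable (tame W) :=
  ((hW.min measurable_const).pow_const 2).mul
    (Real.measurable_exp.comp continuous_slow.measurable.neg)

theorem tame_pos {W : ℝ → ℝ} {x : ℝ} (hW : 0 < W x) : 0 < tame W x :=
  mul_pos (pow_pos (lt_min hW one_pos) 2) (Real.exp_pos _)

theorem integrable_log_tame {W : ℝ → ℝ} (hW : Measurable W) (hlog : LogIntegrable W) :
    Integrable (fun x => Real.log (tame W x)) poissonMeasure := by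
  have h1 : Integrable (fun x => Real.log (min (W x) 1)) poissonMeasure := by
    refine hlog.2.mono (Real.measurable_log.comp (hW.min measurable_const)).aestronglyMeasurable ?_
    refine poissonMeasure_absolutelyContinuous.ae_le ?_
    filter_upwards with x
    rcases le_total (W x) 1 with h | h
    · rw [min_eq_left h]
    · rw [min_eq_right h, Real.log_one, norm_zero]; positivity
  refine ((h1.const_mul 2).sub integrable_slow).congr ?_
  refine poissonMeasure_absolutelyContinuous.ae_le ?_
  filter_upwards [hlog.1] with x hx
  have : 0 < min (W x) 1 := lt_min hx one_pos
  rw [tame, Real.log_mul (by positivity) (Real.exp_pos _).ne', Real.log_exp, Real.log_pow]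
  simp only [Pi.sub_apply]
  push_cast
  ring

theorem integrable_withDensity_ofReal_iff {ω : ℝ → ℝ} (hω : Measurable ω) (h0 : ∀ x, 0 ≤ ω x)
    {E : Type*} [NormedAddCommGroup E] [NormedSpace ℝ E] {g : ℝ → E} :
    Integrable g (volume.withDensity fun x => ENNReal.ofReal (ω x)) ↔
      Integrable fun x => ω x • g x := by
  rw [integrable_withDensity_iff_integrable_smul' hω.ennreal_ofReal (by simp)]
  simp_rw [ENNReal.toReal_ofReal (h0 _)]

theorem integral_withDensity_ofReal {ω : ℝ → ℝ} (hω : Measurable ω) (h0 : ∀ x, 0 ≤ ω x)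
    {E : Type*} [NormedAddCommGroup E] [NormedSpace ℝ E] (g : ℝ → E) :
    ∫ x, g x ∂(volume.withDensity fun x => ENNReal.ofReal (ω x)) = ∫ x, ω x • g x := by
  rw [integral_withDensity_eq_integral_toReal_smul hω.ennreal_ofReal (by simp)]
  simp_rw [ENNReal.toReal_ofReal (h0 _)]

theorem norm_toLp_sq {α : Type*} [MeasurableSpace α] {ν : Measure α} {f : α → ℂ}
    (hf : MemLp f 2 ν) : ‖hf.toLp f‖ ^ 2 = ∫ x, ‖f x‖ ^ 2 ∂ν := by
  have h0 : 0 ≤ ∫ x, ‖f x‖ ^ 2 ∂ν := integral_nonneg fun x => by positivity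
  rw [Lp.norm_toLp, hf.eLpNorm_eq_integral_rpow_norm (by simp) (by simp)]
  simp only [ENNReal.toReal_ofNat, Real.rpow_ofNat]
  rw [ENNReal.toReal_ofReal (by positivity), ← Real.rpow_natCast, ← Real.rpow_mul h0]
  norm_num

/-- In `L²` of the tamed weight, `(x - i)⁻¹` has positive distance from the polynomials, so their
orthogonal complement is nontrivial. Monomials are real on the line, so the conjugate in the inner
product does no harm. -/
theorem exists_orthogonal_of_logIntegrable {W : ℝ → ℝ} (hm : Measurable W) (hW : ∀ x, 0 ≤ W x)
    (hlog : LogIntegrable W) :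
    ∃ h : ℝ → ℂ, MemLp h 2 (volume.withDensity fun x => ENNReal.ofReal (tame W x)) ∧
      ¬ h =ᵐ[volume.withDensity fun x => ENNReal.ofReal (tame W x)] 0 ∧
      ∀ n : ℕ, MemLp (fun x : ℝ => (x : ℂ) ^ n) 2
          (volume.withDensity fun x => ENNReal.ofReal (tame W x)) ∧
        ∫ x : ℝ, (x : ℂ) ^ n * h x ∂(volume.withDensity fun x => ENNReal.ofReal (tame W x)) = 0 := by
  have hωm := measurable_tame hm
  have hω0 := tame_nonneg W
  set ν := volume.withDensity fun x => ENNReal.ofReal (tame W x) with hν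
  have hpow : ∀ n : ℕ, MemLp (fun x : ℝ => (x : ℂ) ^ n) 2 ν := by
    intro n
    rw [memLp_two_iff_integrable_sq_norm (by fun_prop),
      integrable_withDensity_ofReal_iff hωm hω0]
    refine (integrable_pow_mul_exp_neg_slow (2 * n)).mono'
      (hωm.smul (by fun_prop)).aestronglyMeasurable (ae_of_all _ fun x => ?_)
    rw [Real.norm_of_nonneg (smul_nonneg (hω0 x) (by positivity)), smul_eq_mul, norm_pow,
      Complex.norm_real, Real.norm_eq_abs, ← pow_mul, mul_comm, mul_comm n]
    exact mul_le_mul_of_nonneg_left (tame_le (hW x)) (by positivity)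
  have hpoly : ∀ p : ℂ[X], MemLp (fun x : ℝ => p.eval (x : ℂ)) 2 ν := by
    intro p
    simp only [Polynomial.eval_eq_sum_range]
    exact memLp_finsetSum _ fun n _ => (hpow n).const_mul _
  have : IsFiniteMeasure ν := by
    have h1 := (memLp_two_iff_integrable_sq_norm (hpow 0).1).1 (hpow 0)
    simp only [pow_zero, norm_one, one_pow] at h1
    exact (integrable_const_iff_isFiniteMeasure one_ne_zero).1 h1
  have hu : MemLp (fun x : ℝ => ((x : ℂ) - Complex.I)⁻¹) 2 ν :=
    MemLp.of_bound continuous_inv_ofReal_sub_I.aestronglyMeasurable 1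
      (ae_of_all _ norm_inv_ofReal_sub_I_le)
  let T : ℂ[X] →ₗ[ℂ] Lp ℂ 2 ν :=
    { toFun := fun p => (hpoly p).toLp _
      map_add' := fun p q => by
        rw [← MemLp.toLp_add]
        refine MemLp.toLp_congr _ _ (ae_of_all _ fun x => ?_)
        simp
      map_smul' := fun c p => by
        rw [RingHom.id_apply, ← MemLp.toLp_const_smul]
        refine MemLp.toLp_congr _ _ (ae_of_all _ fun x => ?_)
        simp }
  obtain ⟨δ, hδ, hlow⟩ := exists_log_integral_lower_bound
    (hlog.1.mono fun x hx => tame_pos hx) (integrable_log_tame hm hlog)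
  have hnot : hu.toLp _ ∉ closure (LinearMap.range T : Set (Lp ℂ 2 ν)) := by
    intro hmem
    obtain ⟨_, ⟨p, rfl⟩, hp⟩ := Metric.mem_closure_iff.1 hmem (√δ) (Real.sqrt_pos.2 hδ)
    have hsub := hu.sub (hpoly p)
    have h1 : dist (hu.toLp _) (T p) = ‖hsub.toLp _‖ := by
      rw [dist_eq_norm, MemLp.toLp_sub hu (hpoly p)]; rfl
    have h2 := (memLp_two_iff_integrable_sq_norm hsub.1).1 hsub
    rw [integrable_withDensity_ofReal_iff hωm hω0] at h2
    have h3 := hlow p h2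
    have h4 := norm_toLp_sq hsub
    rw [integral_withDensity_ofReal hωm hω0] at h4
    rw [h1, Real.lt_sqrt (norm_nonneg _), h4] at hp
    exact lt_asymm h3 hp
  have hne : (LinearMap.range T)ᗮ ≠ ⊥ := by
    rw [Ne, ← Submodule.topologicalClosure_eq_top_iff]
    intro htop
    refine hnot ?_
    rw [← Submodule.topologicalClosure_coe, htop]
    trivial
  obtain ⟨h, hh, hh0⟩ := Submodule.exists_mem_ne_zero_of_ne_bot hne
  refine ⟨h, Lp.memLp h, fun h0 => hh0 ((Lp.eq_zero_iff_ae_eq_zero).2 h0), fun n => ⟨hpow n, ?_⟩⟩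
  have horth := (Submodule.mem_orthogonal _ _).1 hh (T (Polynomial.X ^ n)) ⟨_, rfl⟩
  rw [L2.inner_def] at horth
  rw [← horth]
  refine integral_congr_ae ?_
  filter_upwards [(hpoly (Polynomial.X ^ n)).coeFn_toLp] with x hx
  have hx' : (T (Polynomial.X ^ n)) x = (x : ℂ) ^ n := by
    rw [← Polynomial.eval_X (x := (x : ℂ)), ← Polynomial.eval_pow]; exact hx
  rw [hx', RCLike.inner_apply, map_pow, Complex.conj_ofReal, mul_comm]

theorem exists_annihilating_of_logIntegrable {W : ℝ → ℝ} (hm : Measurable W) (hW : ∀ x, 0 ≤ W x)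
    (hlog : LogIntegrable W) :
    ∃ μ : ComplexMeasure ℝ, μ ≠ 0 ∧ MemM W μ ∧ MomentsVanish μ := by
  obtain ⟨h, hh, hh0, hmom⟩ := exists_orthogonal_of_logIntegrable hm hW hlog
  have hωm := measurable_tame hm
  have hω0 := tame_nonneg W
  set ν := volume.withDensity fun x => ENNReal.ofReal (tame W x) with hν
  have hint : ∀ n : ℕ, Integrable (fun x : ℝ => (x : ℂ) ^ n * h x) ν := fun n =>
    (hmom n).1.integrable_mul hh
  have hh1 : Integrable h ν := by simpa using hint 0
  have hvar := Measure.variation_withDensityᵥ hh1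
  have hI : ∀ n : ℕ, (ν.withDensityᵥ h).Integrable fun x : ℝ => (x : ℂ) ^ n := by
    intro n
    rw [VectorMeasure.Integrable, hvar,
      integrable_withDensity_iff_integrable_smul₀' hh1.1.enorm (by simp)]
    refine (hint n).mono (hh1.1.norm.smul (by fun_prop)) (ae_of_all _ fun x => ?_)
    simp [mul_comm]
  refine ⟨ν.withDensityᵥ h, fun h0 => hh0 ?_, ?_, fun n => ⟨hI n, ?_⟩⟩
  · rw [← withDensityᵥ_zero (μ := ν)] at h0
    exact hh1.ae_eq_of_withDensityᵥ_eq (integrable_zero _ _ _) h0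
  · have hsq := (memLp_two_iff_integrable_sq_norm hh.1).1 hh
    rw [integrable_withDensity_ofReal_iff hωm hω0] at hsq
    have hexp : Integrable fun x => Real.exp (-slow x) := by
      simpa using integrable_pow_mul_exp_neg_slow 0
    have hfin := (hexp.add hsq).lintegral_lt_top
    have hWm : AEMeasurable (fun x => (ENNReal.ofReal (W x))⁻¹) ν :=
      hm.ennreal_ofReal.inv.aemeasurable
    rw [MemM, hvar, lintegral_withDensity_eq_lintegral_mul₀ hh1.1.enorm hWm, hν,
      lintegral_withDensity_eq_lintegral_mul_non_measurable _ hωm.ennreal_ofReal (by simp)]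
    refine (lintegral_mono_ae ?_).trans_lt hfin
    filter_upwards [hlog.1] with x hx
    simp only [Pi.mul_apply, Pi.add_apply, smul_eq_mul]
    rw [← ofReal_norm, ← ENNReal.ofReal_inv_of_pos hx, ← ENNReal.ofReal_mul (norm_nonneg _),
      ← ENNReal.ofReal_mul (hω0 x)]
    refine ENNReal.ofReal_le_ofReal ?_
    -- The square in `tame` is spent here: one factor `m` cancels `W⁻¹`, the other goes with `‖h‖`
    -- and is absorbed by the `L²` bound.
    set m := min (W x) 1 with hm'
    have hm0 : 0 ≤ m := le_min hx.le zero_le_one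
    have h1 : m * (W x)⁻¹ ≤ 1 := by
      rw [← div_eq_mul_inv, div_le_one hx]; exact min_le_left _ _
    have h2 : m * ‖h x‖ ≤ 1 + (m * ‖h x‖) ^ 2 := by nlinarith [sq_nonneg (m * ‖h x‖ - 1)]
    have h3 : 0 ≤ m * ‖h x‖ := by positivity
    calc tame W x * (‖h x‖ * (W x)⁻¹)
        = Real.exp (-slow x) * ((m * ‖h x‖) * (m * (W x)⁻¹)) := by rw [tame]; ring
      _ ≤ Real.exp (-slow x) * (1 + (m * ‖h x‖) ^ 2) := by
        gcongr
        exact (mul_le_of_le_one_right h3 h1).trans h2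
      _ = Real.exp (-slow x) + tame W x * ‖h x‖ ^ 2 := by rw [tame]; ring
  · rw [integral_withDensityᵥ hh1 (hI n)]
    exact (hmom n).2

/-! ### Decay at a boundary point of the disc -/

theorem circleAverage_le_of_norm_le_exp_neg {H : ℂ → ℂ} {κ : ℂ → ℝ} {C ρ : ℝ}
    (hH : DifferentiableOn ℂ H (Metric.ball 0 1)) (h0 : H 0 ≠ 0)
    (hκ : ContinuousOn κ (Metric.ball 0 1)) (hC : 0 < C)
    (hbound : ∀ z ∈ Metric.ball (0 : ℂ) 1, ‖H z‖ ≤ C * Real.exp (-κ z)) (hρ : 0 < ρ)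
    (hρ1 : ρ < 1) :
    Real.circleAverage κ 0 ρ ≤ Real.log C - Real.log ‖H 0‖ := by
  have hsub : Metric.closedBall (0 : ℂ) ρ ⊆ Metric.ball 0 1 := Metric.closedBall_subset_ball hρ1
  have hsph : Metric.sphere (0 : ℂ) |ρ| ⊆ Metric.closedBall 0 ρ := by
    rw [abs_of_pos hρ]; exact Metric.sphere_subset_closedBall
  have hHa : AnalyticOnNhd ℂ H (Metric.closedBall 0 ρ) :=
    (hH.analyticOnNhd Metric.isOpen_ball).mono hsub
  have hκi : CircleIntegrable κ 0 ρ :=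
    (hκ.mono ((Metric.sphere_subset_closedBall).trans hsub)).circleIntegrable hρ.le
  set b : ℂ → ℝ := fun z => Real.log C - κ z with hb
  have hbi : CircleIntegrable b 0 ρ := (circleIntegrable_const _ _ _).sub hκi
  have hcod : ∀ᶠ z in codiscreteWithin (Metric.sphere (0 : ℂ) |ρ|), H z ≠ 0 := by
    refine (codiscreteWithin_mono hsph) ?_
    refine (hHa.eqOn_zero_or_eventually_ne_zero_of_preconnected
      (convex_closedBall _ _).isPreconnected).resolve_left fun h => h0 ?_
    exact h (Metric.mem_closedBall_self hρ.le)
  classical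
  -- Since `Real.log 0 = 0`, the pointwise bound by `b` may fail at zeros of `H`. These form a
  -- negligible set on the circle, so the value there is replaced by `b`.
  set g : ℂ → ℝ := fun z => if H z = 0 then b z else Real.log ‖H z‖ with hg
  have hfg : (fun z => Real.log ‖H z‖) =ᶠ[codiscreteWithin (Metric.sphere (0 : ℂ) |ρ|)] g := by
    filter_upwards [hcod] with z hz
    simp only [hg, if_neg hz]
  have hgi : CircleIntegrable g 0 ρ := by
    refine CircleIntegrable.congr_codiscreteWithin hfg ?_
    exact MeromorphicOn.circleIntegrable_log_norm fun z hz => (hHa z (hsph hz)).meromorphicAt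
  have h1 := log_norm_le_circleAverage hρ hHa h0
  rw [Real.circleAverage_congr_codiscreteWithin hfg hρ.ne'] at h1
  have h2 : Real.circleAverage g 0 ρ ≤ Real.circleAverage b 0 ρ := by
    refine Real.circleAverage_mono hgi hbi fun z hz => ?_
    by_cases hz0 : H z = 0
    · simp only [hg, if_pos hz0, le_refl]
    · simp only [hg, if_neg hz0, hb]
      have := Real.log_le_log (norm_pos_iff.2 hz0) (hbound z (hsub (hsph hz)))
      rwa [Real.log_mul hC.ne' (Real.exp_pos _).ne', Real.log_exp, ← sub_eq_add_neg] at this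
  have h3 : Real.circleAverage b 0 ρ = Real.log C - Real.circleAverage κ 0 ρ := by
    rw [hb, Real.circleAverage_fun_sub (circleIntegrable_const _ _ _) hκi,
      Real.circleAverage_const]
  linarith

theorem norm_one_sub_circleMap_le {θ : ℝ} (hθ : 0 ≤ θ) : ‖1 - circleMap 0 1 θ‖ ≤ θ := by
  have h := Real.norm_exp_I_mul_ofReal_sub_one_le (x := θ)
  rw [Real.norm_of_nonneg hθ, mul_comm, norm_sub_rev] at h
  simpa [circleMap] using h

theorem circleMap_mem_ball {ρ : ℝ} (h0 : 0 ≤ ρ) (h1 : ρ < 1) (θ : ℝ) :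
    circleMap 0 ρ θ ∈ Metric.ball (0 : ℂ) 1 := by
  simpa [abs_of_nonneg h0] using h1

theorem one_sub_ne_zero_of_mem_ball {z : ℂ} (hz : z ∈ Metric.ball (0 : ℂ) 1) : 1 - z ≠ 0 := by
  intro h
  rw [← sub_eq_zero.1 h] at hz
  simp at hz

/-- Jensen's inequality bounds the means of `k(1/|1 - z|)` uniformly over circles of radius `ρ < 1`.
Fatou's lemma lets `ρ → 1`, and since the chord is at most the arc, `k(1/θ) ≤ k(1/|1 - exp(iθ)|)`.
-/
theorem lintegral_comp_inv_lt_top {H : ℂ → ℂ} {k : ℝ → ℝ} {C : ℝ}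
    (hH : DifferentiableOn ℂ H (Metric.ball 0 1)) (h0 : H 0 ≠ 0) (hk : Continuous k)
    (hmono : Monotone k) (hk0 : ∀ x, 0 ≤ k x) (hC : 0 < C)
    (hbound : ∀ z ∈ Metric.ball (0 : ℂ) 1, ‖H z‖ ≤ C * Real.exp (-k ‖1 - z‖⁻¹)) :
    ∫⁻ θ in Ioo (0 : ℝ) 1, ENNReal.ofReal (k θ⁻¹) < ⊤ := by
  set B := Real.log C - Real.log ‖H 0‖ with hB
  have hκ : ContinuousOn (fun z : ℂ => k ‖1 - z‖⁻¹) (Metric.ball 0 1) :=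
    hk.comp_continuousOn ((by fun_prop : Continuous fun z : ℂ => ‖1 - z‖).continuousOn.inv₀
      fun z hz => norm_ne_zero_iff.2 (one_sub_ne_zero_of_mem_ball hz))
  set ρ : ℕ → ℝ := fun n => 1 - 1 / (n + 2 : ℝ) with hρ
  have hρ0 : ∀ n, 0 < ρ n := fun n => by
    have : (1 : ℝ) / (n + 2) < 1 := by rw [div_lt_one (by positivity)]; linarith [n.cast_nonneg (α := ℝ)]
    simp only [hρ]; linarith
  have hρ1 : ∀ n, ρ n < 1 := fun n => by
    have : (0 : ℝ) < 1 / (n + 2) := by positivity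
    simp only [hρ]; linarith
  have hρt : Tendsto ρ atTop (𝓝 1) := by
    have h := (tendsto_one_div_add_atTop_nhds_zero_nat (𝕜 := ℝ)).comp (tendsto_add_atTop_nat 1)
    have h2 : Tendsto (fun n : ℕ => 1 - 1 / (n + 2 : ℝ)) atTop (𝓝 (1 - 0)) := by
      refine tendsto_const_nhds.sub (h.congr fun n => ?_)
      simp only [Function.comp]
      push_cast
      ring_nf
    rwa [sub_zero] at h2
  set F : ℕ → ℝ → ℝ := fun n θ => k ‖1 - circleMap 0 (ρ n) θ‖⁻¹ with hF
  have hFc : ∀ n, Continuous (F n) := fun n =>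
    hκ.comp_continuous (continuous_circleMap 0 (ρ n)) (circleMap_mem_ball (hρ0 n).le (hρ1 n))
  have hFint : ∀ n, ∫⁻ θ in Ioo (0 : ℝ) 1, ENNReal.ofReal (F n θ) ≤
      ENNReal.ofReal (2 * Real.pi * B) := by
    intro n
    have h1 := circleAverage_le_of_norm_le_exp_neg hH h0 hκ hC hbound (hρ0 n) (hρ1 n)
    rw [Real.circleAverage, smul_eq_mul, inv_mul_le_iff₀ Real.two_pi_pos] at h1
    have h2 : ∫⁻ θ in Ioo (0 : ℝ) 1, ENNReal.ofReal (F n θ) ≤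
        ∫⁻ θ in Ioc 0 (2 * Real.pi), ENNReal.ofReal (F n θ) := by
      refine lintegral_mono_set fun θ hθ => ⟨hθ.1, hθ.2.le.trans ?_⟩
      linarith [Real.pi_gt_three]
    refine h2.trans ?_
    rw [← ofReal_integral_eq_lintegral_ofReal ((hFc n).integrableOn_Ioc)
      (ae_of_all _ fun θ => hk0 _), ← intervalIntegral.integral_of_le Real.two_pi_pos.le]
    exact ENNReal.ofReal_le_ofReal h1
  have hlim : ∀ θ ∈ Ioo (0 : ℝ) 1, ENNReal.ofReal (k θ⁻¹) ≤
      liminf (fun n => ENNReal.ofReal (F n θ)) atTop := by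
    intro θ hθ
    have hne : 1 - circleMap 0 1 θ ≠ 0 := by
      intro h
      have h' : Complex.exp (θ * Complex.I) = 1 := by
        simpa [circleMap] using (sub_eq_zero.1 h).symm
      have := congrArg Complex.im h'
      rw [Complex.exp_ofReal_mul_I_im, Complex.one_im] at this
      exact (Real.sin_pos_of_pos_of_lt_pi hθ.1 (by linarith [hθ.2, Real.pi_gt_three])).ne' this
    have ht : Tendsto (fun n => ENNReal.ofReal (F n θ)) atTop
        (𝓝 (ENNReal.ofReal (k ‖1 - circleMap 0 1 θ‖⁻¹))) := by
      refine (ENNReal.continuous_ofReal.tendsto _).comp ((hk.tendsto _).comp ?_)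
      refine Tendsto.inv₀ ?_ (norm_ne_zero_iff.2 hne)
      have hc : Continuous fun r : ℝ => ‖1 - circleMap 0 r θ‖ := by
        unfold circleMap; fun_prop
      exact (hc.tendsto 1).comp hρt
    rw [ht.liminf_eq]
    refine ENNReal.ofReal_le_ofReal (hmono ?_)
    exact inv_anti₀ (norm_pos_iff.2 hne) (norm_one_sub_circleMap_le hθ.1.le)
  calc ∫⁻ θ in Ioo (0 : ℝ) 1, ENNReal.ofReal (k θ⁻¹)
      ≤ ∫⁻ θ in Ioo (0 : ℝ) 1, liminf (fun n => ENNReal.ofReal (F n θ)) atTop :=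
        setLIntegral_mono' measurableSet_Ioo hlim
    _ ≤ liminf (fun n => ∫⁻ θ in Ioo (0 : ℝ) 1, ENNReal.ofReal (F n θ)) atTop :=
        lintegral_liminf_le fun n => (hFc n).measurable.ennreal_ofReal
    _ ≤ liminf (fun _ : ℕ => ENNReal.ofReal (2 * Real.pi * B)) atTop :=
        liminf_le_liminf (Eventually.of_forall hFint)
    _ < ⊤ := by rw [liminf_const]; exact ENNReal.ofReal_lt_top

/-- Put `θ = 1/x` for `x > 1`: the Jacobian `x⁻²` dominates `(1 + x²)⁻¹`. Reflection handles `x <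
-1`, and on `[-1, 1]` monotonicity gives `k |x| ≤ k 1`. -/
theorem lintegral_poissonMeasure_comp_abs_lt_top {k : ℝ → ℝ} (hk : Measurable k)
    (hmono : Monotone k)
    (hfin : ∫⁻ θ in Ioo (0 : ℝ) 1, ENNReal.ofReal (k θ⁻¹) < ⊤) :
    ∫⁻ x, ENNReal.ofReal (k |x|) ∂poissonMeasure < ⊤ := by
  set φ : ℝ → ℝ≥0∞ :=
    (Ioi (1 : ℝ)).indicator fun x => ENNReal.ofReal (1 + x ^ 2)⁻¹ * ENNReal.ofReal (k x) with hφ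
  have hφm : Measurable φ := by
    refine Measurable.indicator ?_ measurableSet_Ioi
    exact measurable_poissonDensity.mul hk.ennreal_ofReal
  have hφfin : ∫⁻ x, φ x < ⊤ := by
    have himg : Ioo (0 : ℝ) 1 = (fun x : ℝ => x⁻¹) '' Ioi 1 := by
      ext y
      simp only [mem_Ioo, mem_image, mem_Ioi]
      constructor
      · rintro ⟨h1, h2⟩
        exact ⟨y⁻¹, (one_lt_inv₀ h1).2 h2, inv_inv y⟩
      · rintro ⟨x, hx, rfl⟩
        exact ⟨inv_pos.2 (by linarith), inv_lt_one_of_one_lt₀ hx⟩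
    rw [himg, lintegral_image_eq_lintegral_abs_deriv_mul measurableSet_Ioi
      (fun x hx => (hasDerivAt_inv (by simp only [mem_Ioi] at hx; linarith)).hasDerivWithinAt)
      inv_injective.injOn] at hfin
    rw [hφ, lintegral_indicator measurableSet_Ioi]
    refine (setLIntegral_mono' measurableSet_Ioi fun x hx => ?_).trans_lt hfin
    simp only [mem_Ioi] at hx
    rw [inv_inv, abs_neg, abs_of_nonneg (by positivity)]
    gcongr
    linarith
  have hφneg : ∫⁻ x, φ (-x) = ∫⁻ x, φ x :=
    (Measure.measurePreserving_neg (volume : Measure ℝ)).lintegral_comp hφm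
  have hc : ∫⁻ x : ℝ, ENNReal.ofReal (1 + x ^ 2)⁻¹ * ENNReal.ofReal (k 1) < ⊤ := by
    rw [lintegral_mul_const _ measurable_poissonDensity]
    exact ENNReal.mul_lt_top integrable_inv_one_add_sq.lintegral_lt_top ENNReal.ofReal_lt_top
  have hm : AEMeasurable fun x : ℝ => ENNReal.ofReal (k |x|) :=
    (hk.comp measurable_id.abs).ennreal_ofReal.aemeasurable
  rw [lintegral_poissonMeasure hm]
  refine lt_of_le_of_lt (b := ∫⁻ x, (ENNReal.ofReal (1 + x ^ 2)⁻¹ * ENNReal.ofReal (k 1) +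
    (φ x + φ (-x)))) (lintegral_mono fun x => ?_) ?_
  · rcases le_or_gt |x| 1 with h | h
    · refine le_add_right ?_
      gcongr
      exact hmono h
    · refine le_add_left ?_
      rcases le_total 0 x with hx | hx
      · refine le_add_right ?_
        rw [abs_of_nonneg hx] at h ⊢
        rw [hφ, indicator_of_mem (mem_Ioi.2 h)]
      · refine le_add_left ?_
        rw [abs_of_nonpos hx] at h ⊢
        rw [hφ, indicator_of_mem (mem_Ioi.2 h), neg_sq]
  · rw [lintegral_add_right _ (by fun_prop), lintegral_add_left hφm, hφneg]
    simp [hc, hφfin]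

/-! ### Resolvents and the closure of the weighted polynomials -/

/-- The function `t ↦ (t - z)⁻¹`, for non-real `z`. -/
noncomputable def resolvent (z : ℂ) : ℝ →ᵇ ℂ :=
  if hz : z.im = 0 then 0 else
    BoundedContinuousFunction.ofNormedAddCommGroup (fun t : ℝ => ((t : ℂ) - z)⁻¹)
      ((by fun_prop : Continuous fun t : ℝ => (t : ℂ) - z).inv₀ fun t h => hz (by
        have := congrArg Complex.im h
        simpa using this)) |z.im|⁻¹ fun t => by
      rw [norm_inv]
      refine inv_anti₀ (abs_pos.2 hz) ?_
      simpa using Complex.abs_im_le_norm ((t : ℂ) - z)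

theorem resolvent_apply {z : ℂ} (hz : z.im ≠ 0) (t : ℝ) : resolvent z t = ((t : ℂ) - z)⁻¹ := by
  rw [resolvent, dif_neg hz]; rfl

theorem ofReal_sub_ne_zero {z : ℂ} (hz : z.im ≠ 0) (t : ℝ) : (t : ℂ) - z ≠ 0 := fun h =>
  hz (by simpa using congrArg Complex.im h)

theorem norm_resolvent_le {z : ℂ} (hz : z.im ≠ 0) : ‖resolvent z‖ ≤ |z.im|⁻¹ := by
  rw [resolvent, dif_neg hz]
  exact BoundedContinuousFunction.norm_ofNormedAddCommGroup_le _ (inv_nonneg.2 (abs_nonneg _)) _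

theorem resolvent_sub_resolvent {z w : ℂ} (hz : z.im ≠ 0) (hw : w.im ≠ 0) :
    resolvent z - resolvent w = (z - w) • (resolvent z * resolvent w) := by
  ext t
  have h1 := ofReal_sub_ne_zero hz t
  have h2 := ofReal_sub_ne_zero hw t
  simp only [BoundedContinuousFunction.coe_sub, Pi.sub_apply, BoundedContinuousFunction.coe_smul,
    BoundedContinuousFunction.coe_mul, Pi.mul_apply, resolvent_apply hz, resolvent_apply hw,
    smul_eq_mul]
  field_simp
  ring

/-- Holomorphy in the sup norm, from the resolvent identity; composing with any continuous
functional then gives a scalar analytic function. -/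
theorem differentiableAt_resolvent {z : ℂ} (hz : 0 < z.im) :
    DifferentiableAt ℂ resolvent z := by
  have hnhds : ∀ᶠ w in 𝓝 z, z.im / 2 < w.im :=
    (Complex.continuous_im.tendsto z).eventually (lt_mem_nhds (by linarith))
  have hcont : Tendsto resolvent (𝓝 z) (𝓝 (resolvent z)) := by
    rw [tendsto_iff_norm_sub_tendsto_zero]
    have hlim : Tendsto (fun w => ‖w - z‖ * ((z.im / 2)⁻¹ * |z.im|⁻¹)) (𝓝 z) (𝓝 0) := by
      have : Continuous fun w => ‖w - z‖ * ((z.im / 2)⁻¹ * |z.im|⁻¹) := by fun_prop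
      simpa using this.tendsto z
    refine squeeze_zero' (Eventually.of_forall fun w => norm_nonneg _) ?_ hlim
    filter_upwards [hnhds] with w hw
    have hw0 : 0 < w.im := by linarith
    rw [resolvent_sub_resolvent hw0.ne' hz.ne', norm_smul]
    refine mul_le_mul_of_nonneg_left ((norm_mul_le _ _).trans ?_) (norm_nonneg _)
    refine mul_le_mul ((norm_resolvent_le hw0.ne').trans ?_) (norm_resolvent_le hz.ne')
      (norm_nonneg _) (by positivity)
    rw [abs_of_pos hw0]
    exact inv_anti₀ (by linarith) hw.le
  refine HasDerivAt.differentiableAt (f' := resolvent z * resolvent z) ?_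
  rw [hasDerivAt_iff_tendsto_slope]
  have hmul : Tendsto (fun w => resolvent w * resolvent z) (𝓝[≠] z)
      (𝓝 (resolvent z * resolvent z)) :=
    (hcont.mono_left nhdsWithin_le_nhds).mul tendsto_const_nhds
  refine hmul.congr' ?_
  filter_upwards [self_mem_nhdsWithin, mem_nhdsWithin_of_mem_nhds hnhds] with w hw hw'
  have hw0 : 0 < w.im := lt_trans (by linarith) hw'
  rw [slope_def_module, resolvent_sub_resolvent hw0.ne' hz.ne', smul_smul,
    inv_mul_cancel₀ (sub_ne_zero.2 hw), one_smul]

/-- The weight `exp (-k |x|)`. -/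
noncomputable def expWeight (k : ℝ → ℝ) (x : ℝ) : ℝ := Real.exp (-k |x|)

theorem continuous_expWeight {k : ℝ → ℝ} (hk : Continuous k) : Continuous (expWeight k) := by
  unfold expWeight; fun_prop

theorem RapidlyDecaying.tendsto_mul_eval {W : ℝ → ℝ} (hW : RapidlyDecaying W) (p : ℂ[X]) :
    Tendsto (fun x : ℝ => (W x : ℂ) * p.eval (x : ℂ)) (cocompact ℝ) (𝓝 0) := by
  simp only [Polynomial.eval_eq_sum_range, Finset.mul_sum]
  rw [← Finset.sum_const_zero (s := Finset.range (p.natDegree + 1))]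
  refine tendsto_finsetSum _ fun n _ => ?_
  have h := (hW n).norm.const_mul ‖p.coeff n‖
  rw [norm_zero, mul_zero] at h
  refine squeeze_zero_norm (fun x => le_of_eq ?_) h
  simp only [norm_mul, norm_pow, Complex.norm_real, Real.norm_eq_abs, abs_abs]
  ring

theorem exists_bound_of_tendsto_cocompact {f : ℝ → ℂ} (hf : Continuous f)
    (h : Tendsto f (cocompact ℝ) (𝓝 0)) : ∃ C, ∀ x, ‖f x‖ ≤ C := by
  obtain ⟨C, hC⟩ := (ZeroAtInftyContinuousMap.isBounded_range
    (⟨⟨f, hf⟩, h⟩ : ZeroAtInftyContinuousMap ℝ ℂ)).exists_norm_le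
  exact ⟨C, fun x => hC _ ⟨x, rfl⟩⟩

section

variable {G : ℝ → ℝ}

/-- The weighted polynomial `G p` as a bounded continuous function. -/
noncomputable def weightedPoly (hG : Continuous G) (hdecay : RapidlyDecaying G) :
    ℂ[X] →ₗ[ℂ] ℝ →ᵇ ℂ where
  toFun p :=
    have hc : Continuous fun x : ℝ => (G x : ℂ) * p.eval (x : ℂ) := by fun_prop
    have hb := exists_bound_of_tendsto_cocompact hc (hdecay.tendsto_mul_eval p)
    BoundedContinuousFunction.ofNormedAddCommGroup _ hc hb.choose hb.choose_spec
  map_add' p q := by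
    ext x
    simp [mul_add]
  map_smul' c p := by
    ext x
    simp [mul_left_comm]

theorem weightedPoly_apply (hG : Continuous G) (hdecay : RapidlyDecaying G) (p : ℂ[X]) (x : ℝ) :
    weightedPoly hG hdecay p x = (G x : ℂ) * p.eval (x : ℂ) := rfl

/-- The closure of the weighted polynomials `G p`. -/
noncomputable def polyClosure (hG : Continuous G) (hdecay : RapidlyDecaying G) :
    Submodule ℂ (ℝ →ᵇ ℂ) := (LinearMap.range (weightedPoly hG hdecay)).topologicalClosure

variable (hG : Continuous G) (hdecay : RapidlyDecaying G)

theorem weightedPoly_mem_polyClosure (p : ℂ[X]) :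
    weightedPoly hG hdecay p ∈ polyClosure hG hdecay :=
  Submodule.le_topologicalClosure _ ⟨p, rfl⟩

theorem isClosed_polyClosure : IsClosed (polyClosure hG hdecay : Set (ℝ →ᵇ ℂ)) :=
  Submodule.isClosed_topologicalClosure _

/-- Division by `X - z`: `p(t) = (t - z) q(t) + p(z)`. Modulo weighted polynomials, the resolvent
therefore sees `p` only through `p(z)`. -/
theorem resolvent_mul_weightedPoly {z : ℂ} (hz : z.im ≠ 0) (p : ℂ[X]) :
    ∃ q : ℂ[X], resolvent z * weightedPoly hG hdecay p =
      weightedPoly hG hdecay q + p.eval z • (resolvent z * weightedPoly hG hdecay 1) := by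
  refine ⟨p /ₘ (Polynomial.X - Polynomial.C z), ?_⟩
  ext t
  have h := congrArg (Polynomial.eval (t : ℂ))
    (Polynomial.X_sub_C_mul_divByMonic_eq_sub_modByMonic p z)
  rw [Polynomial.modByMonic_X_sub_C_eq_C_eval] at h
  simp only [Polynomial.eval_mul, Polynomial.eval_sub, Polynomial.eval_X, Polynomial.eval_C] at h
  have h1 := ofReal_sub_ne_zero hz t
  simp only [BoundedContinuousFunction.coe_mul, Pi.mul_apply, BoundedContinuousFunction.coe_add,
    Pi.add_apply, BoundedContinuousFunction.coe_smul, weightedPoly_apply, resolvent_apply hz,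
    Polynomial.eval_one, smul_eq_mul]
  field_simp
  linear_combination (-(G t : ℂ)) * h

theorem norm_weightedPoly_X_pow_le {n : ℕ} {M : ℝ} (hM : 0 ≤ M)
    (h : ∀ t, |G t| * |t| ^ n ≤ M) : ‖weightedPoly hG hdecay (Polynomial.X ^ n)‖ ≤ M := by
  rw [BoundedContinuousFunction.norm_le hM]
  intro t
  rw [weightedPoly_apply, Polynomial.eval_pow, Polynomial.eval_X, norm_mul, norm_pow,
    Complex.norm_real, Complex.norm_real]
  exact h t

/-- If `resolvent z * G` is separated from the weighted polynomials, the Cauchy transform of a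
separating functional decays as fast as `G`. -/
theorem norm_apply_resolvent_le {L : (ℝ →ᵇ ℂ) →L[ℂ] ℂ}
    (hL : ∀ p, L (weightedPoly hG hdecay p) = 0) {z : ℂ} (hz : 0 < z.im) {n : ℕ} {M : ℝ}
    (hM : 0 ≤ M) (h : ∀ t, |G t| * |t| ^ n ≤ M * ‖z‖ ^ n) :
    ‖L (resolvent z * weightedPoly hG hdecay 1)‖ ≤ ‖L‖ * M / z.im := by
  -- Applying `L` to the division identity for `X ^ n` gains the factor `‖z‖ ^ n`.
  obtain ⟨q, hq⟩ := resolvent_mul_weightedPoly hG hdecay hz.ne' (Polynomial.X ^ n)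
  have hz0 : 0 < ‖z‖ ^ n := pow_pos (norm_pos_iff.2 fun h => by simp [h] at hz) n
  have h1 : ‖z‖ ^ n * ‖L (resolvent z * weightedPoly hG hdecay 1)‖ =
      ‖L (resolvent z * weightedPoly hG hdecay (Polynomial.X ^ n))‖ := by
    rw [hq, map_add, hL, zero_add, map_smul, norm_smul, Polynomial.eval_pow, Polynomial.eval_X,
      norm_pow]
  have h2 : ‖L (resolvent z * weightedPoly hG hdecay (Polynomial.X ^ n))‖ ≤
      ‖L‖ * (z.im⁻¹ * (M * ‖z‖ ^ n)) := by
    refine (L.le_opNorm _).trans (mul_le_mul_of_nonneg_left ((norm_mul_le _ _).trans ?_)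
      (norm_nonneg _))
    refine mul_le_mul ?_ (norm_weightedPoly_X_pow_le hG hdecay (by positivity) h) (norm_nonneg _)
      (by positivity)
    simpa [abs_of_pos hz] using norm_resolvent_le hz.ne'
  rw [← h1] at h2
  refine le_of_mul_le_mul_left (h2.trans_eq ?_) hz0
  field_simp

end

/-- Hahn–Banach in the quotient by `V`, which is normed because `V` is closed. -/
theorem exists_continuousLinearMap_eq_zero_ne_zero {E : Type*} [NormedAddCommGroup E]
    [NormedSpace ℂ E] {V : Submodule ℂ E} (hV : IsClosed (V : Set E)) {x : E} (hx : x ∉ V) :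
    ∃ L : E →L[ℂ] ℂ, (∀ v ∈ V, L v = 0) ∧ L x ≠ 0 := by
  have hx0 : V.mkQ x ≠ 0 := by simpa using hx
  obtain ⟨g, -, hg⟩ := exists_dual_vector ℂ (V.mkQ x) (norm_ne_zero_iff.2 hx0)
  refine ⟨g.comp V.mkQL, fun v hv => ?_, ?_⟩
  · have : V.mkQL v = 0 := by simpa using hv
    rw [ContinuousLinearMap.comp_apply, this, map_zero]
  · change g (V.mkQ x) ≠ 0
    rw [hg]
    simpa using hx0

/-! ### Divergent logarithmic integral: the resolvent is approximable -/

/-- `k` grows regularly: near each radius `r` some monomial is almost extremal. -/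
def HasExtremalMonomials (k : ℝ → ℝ) : Prop :=
  ∃ C : ℝ, 0 < C ∧ ∀ r, 0 ≤ r → ∃ n : ℕ, ∀ t, 0 ≤ t →
    Real.exp (-k t) * t ^ n ≤ C * (1 + r) * Real.exp (-k r) * r ^ n

/-- The disc `|1 - w| < 1` has the origin on its boundary, so `w ↦ i / w` carries it to a
half-plane. -/
theorem half_lt_im_I_div {w : ℂ} (hw : ‖1 - w‖ < 1) : 1 / 2 < (Complex.I / w).im := by
  have hw0 : w ≠ 0 := by rintro rfl; simp at hw
  have h1 : 0 < Complex.normSq w := Complex.normSq_pos.2 hw0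
  have h2 : ‖1 - w‖ ^ 2 < 1 := by nlinarith [norm_nonneg (1 - w)]
  rw [← Complex.normSq_eq_norm_sq, Complex.normSq_sub] at h2
  simp only [map_one, one_mul, Complex.conj_re] at h2
  have h3 : (Complex.I / w).im = w.re / Complex.normSq w := by
    rw [div_eq_mul_inv, Complex.I_mul_im, Complex.inv_re]
  rw [h3, lt_div_iff₀ h1]
  linarith

variable {k : ℝ → ℝ}

/-- A separating functional would yield an analytic function on the disc, nonzero at the centre and
decaying like `exp(-k(1/|1 - ζ|))` at `1`, which makes `∫ k(|x|) dP` finite. -/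
theorem resolvent_I_mul_mem_polyClosure (hk : Continuous k) (hmono : Monotone k)
    (hk0 : ∀ x, 0 ≤ k x) (hext : HasExtremalMonomials k)
    (hdecay : RapidlyDecaying (expWeight k))
    (hdiv : ∫⁻ x, ENNReal.ofReal (k |x|) ∂poissonMeasure = ⊤) :
    resolvent Complex.I * weightedPoly (continuous_expWeight hk) hdecay 1 ∈
      polyClosure (continuous_expWeight hk) hdecay := by
  by_contra hnot
  set P := weightedPoly (continuous_expWeight hk) hdecay
  obtain ⟨L, hL, hL0⟩ := exists_continuousLinearMap_eq_zero_ne_zero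
    (isClosed_polyClosure (continuous_expWeight hk) hdecay) hnot
  obtain ⟨C, hC, hreg⟩ := hext
  -- The centre `ζ = 0` corresponds to `z = i`. The factor `1 - ζ` compensates the loss `1 + r` in
  -- `HasExtremalMonomials`, where `r = 1/|1 - ζ|`.
  set H : ℂ → ℂ := fun ζ => (1 - ζ) * L (resolvent (Complex.I / (1 - ζ)) * P 1) with hH
  have hball : ∀ ζ ∈ Metric.ball (0 : ℂ) 1, ‖1 - (1 - ζ)‖ < 1 := fun ζ hζ => by
    simpa using hζ
  have him : ∀ ζ ∈ Metric.ball (0 : ℂ) 1, 1 / 2 < (Complex.I / (1 - ζ)).im := fun ζ hζ =>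
    half_lt_im_I_div (hball ζ hζ)
  have hdiff : DifferentiableOn ℂ H (Metric.ball 0 1) := by
    intro ζ hζ
    refine DifferentiableAt.differentiableWithinAt ?_
    have h1 : DifferentiableAt ℂ (fun ζ : ℂ => Complex.I / (1 - ζ)) ζ :=
      (differentiableAt_const _).div (by fun_prop) (one_sub_ne_zero_of_mem_ball hζ)
    have h2 : DifferentiableAt ℂ (fun ζ : ℂ => resolvent (Complex.I / (1 - ζ))) ζ :=
      DifferentiableAt.comp (g := resolvent) ζ
        (differentiableAt_resolvent (by linarith [him ζ hζ])) h1
    have h3 : DifferentiableAt ℂ (fun ζ : ℂ => resolvent (Complex.I / (1 - ζ)) * P 1) ζ :=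
      h2.mul_const _
    exact (by fun_prop : DifferentiableAt ℂ (fun ζ : ℂ => 1 - ζ) ζ).mul
      (L.differentiableAt.comp ζ h3)
  have hH0 : H 0 ≠ 0 := by simpa [hH] using hL0
  have hbound : ∀ ζ ∈ Metric.ball (0 : ℂ) 1,
      -- Here `6 = 2 · 3`: `1 / Im z < 2` and `|w| (1 + 1/|w|) ≤ 3`. The `+ 1` only secures a
      -- positive constant.
      ‖H ζ‖ ≤ (6 * ‖L‖ * C + 1) * Real.exp (-k ‖1 - ζ‖⁻¹) := by
    intro ζ hζ
    set w := 1 - ζ with hw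
    have hw0 : 0 < ‖w‖ := norm_pos_iff.2 (one_sub_ne_zero_of_mem_ball hζ)
    have hw2 : ‖w‖ ≤ 2 := by
      have h1 : ‖ζ‖ < 1 := by simpa using hζ
      have h2 := norm_sub_le 1 ζ
      rw [norm_one] at h2
      linarith
    have hz : ‖Complex.I / w‖ = ‖w‖⁻¹ := by rw [norm_div, Complex.norm_I, one_div]
    obtain ⟨n, hn⟩ := hreg ‖w‖⁻¹ (by positivity)
    have h := norm_apply_resolvent_le (continuous_expWeight hk) hdecay
      (fun p => hL _ (weightedPoly_mem_polyClosure _ _ p)) (z := Complex.I / w)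
      (by linarith [him ζ hζ]) (n := n) (M := C * (1 + ‖w‖⁻¹) * Real.exp (-k ‖w‖⁻¹))
      (by positivity) fun t => by
        rw [hz, expWeight, abs_of_pos (Real.exp_pos _)]
        exact hn |t| (abs_nonneg t)
    have h2 : ‖L‖ * (C * (1 + ‖w‖⁻¹) * Real.exp (-k ‖w‖⁻¹)) / (Complex.I / w).im ≤
        ‖L‖ * (C * (1 + ‖w‖⁻¹) * Real.exp (-k ‖w‖⁻¹)) * 2 := by
      rw [div_eq_mul_inv]
      refine mul_le_mul_of_nonneg_left ?_ (by positivity)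
      have := inv_anti₀ (by norm_num : (0 : ℝ) < 1 / 2) (him ζ hζ).le
      simpa using this
    calc ‖H ζ‖ = ‖w‖ * ‖L (resolvent (Complex.I / w) * P 1)‖ := norm_mul _ _
      _ ≤ ‖w‖ * (‖L‖ * (C * (1 + ‖w‖⁻¹) * Real.exp (-k ‖w‖⁻¹)) * 2) := by
        gcongr; exact h.trans h2
      _ = 2 * ‖L‖ * C * (‖w‖ + 1) * Real.exp (-k ‖w‖⁻¹) := by field_simp
      _ ≤ (6 * ‖L‖ * C + 1) * Real.exp (-k ‖w‖⁻¹) := by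
        gcongr
        have : 0 ≤ ‖L‖ * C := by positivity
        nlinarith
  exact (lintegral_poissonMeasure_comp_abs_lt_top hk.measurable hmono
    (lintegral_comp_inv_lt_top hdiff hH0 hk hmono hk0 (by positivity) hbound)).ne hdiv

/-! ### From the resolvent to density: multipliers and Stone–Weierstrass -/

section

variable {G : ℝ → ℝ} (hG : Continuous G) (hdecay : RapidlyDecaying G)

theorem star_weightedPoly (p : ℂ[X]) : star (weightedPoly hG hdecay p) =
    weightedPoly hG hdecay (p.map (starRingEnd ℂ)) := by
  ext t
  rw [BoundedContinuousFunction.star_apply, weightedPoly_apply, weightedPoly_apply,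
    Polynomial.eval_map]
  have h := Polynomial.eval₂_at_apply (p := p) (starRingEnd ℂ) (t : ℂ)
  rw [Complex.conj_ofReal] at h
  simp [h]

theorem star_mem_polyClosure {v : ℝ →ᵇ ℂ} (hv : v ∈ polyClosure hG hdecay) :
    star v ∈ polyClosure hG hdecay := by
  refine map_mem_closure continuous_star hv ?_
  rintro _ ⟨p, rfl⟩
  exact ⟨p.map (starRingEnd ℂ), (star_weightedPoly hG hdecay p).symm⟩

theorem star_resolvent_I : star (resolvent Complex.I) = resolvent (-Complex.I) := by
  ext t
  rw [BoundedContinuousFunction.star_apply, resolvent_apply (by simp), resolvent_apply (by simp)]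
  simp

theorem resolvent_mul_mem_polyClosure {z : ℂ} (hz : z.im ≠ 0)
    (h : resolvent z * weightedPoly hG hdecay 1 ∈ polyClosure hG hdecay) {v : ℝ →ᵇ ℂ}
    (hv : v ∈ polyClosure hG hdecay) : resolvent z * v ∈ polyClosure hG hdecay := by
  have hmaps : MapsTo (fun v => resolvent z * v)
      (LinearMap.range (weightedPoly hG hdecay) : Set (ℝ →ᵇ ℂ)) (polyClosure hG hdecay) := by
    rintro _ ⟨p, rfl⟩
    obtain ⟨q, hq⟩ := resolvent_mul_weightedPoly hG hdecay hz p
    have := (polyClosure hG hdecay).add_mem (weightedPoly_mem_polyClosure hG hdecay q)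
      ((polyClosure hG hdecay).smul_mem (p.eval z) h)
    rwa [← hq] at this
  have := map_mem_closure (continuous_const_mul (resolvent z)) hv hmaps
  rwa [(isClosed_polyClosure hG hdecay).closure_eq] at this

/-- Restriction of a continuous function from the one-point compactification to the line. -/
noncomputable def restrictLine (g : C(OnePoint ℝ, ℂ)) : ℝ →ᵇ ℂ :=
  (BoundedContinuousFunction.mkOfCompact g).compContinuous ⟨_, OnePoint.continuous_coe⟩

theorem continuous_restrictLine : Continuous restrictLine :=
  (BoundedContinuousFunction.continuous_compContinuous _).comp
    (ContinuousMap.isometryEquivBoundedOfCompact (OnePoint ℝ) ℂ).isometry.continuous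

/-- The functions on the compactified line which multiply the closure of the weighted polynomials
into itself. -/
noncomputable def multiplierAlgebra : Subalgebra ℂ C(OnePoint ℝ, ℂ) where
  carrier := {g | ∀ v ∈ polyClosure hG hdecay, restrictLine g * v ∈ polyClosure hG hdecay}
  mul_mem' {f g} hf hg v hv := by
    have h := hf _ (hg v hv)
    rw [← mul_assoc] at h
    exact h
  add_mem' {f g} hf hg v hv := by
    have h := (polyClosure hG hdecay).add_mem (hf v hv) (hg v hv)
    rw [← add_mul] at h
    exact h
  algebraMap_mem' c v hv := (polyClosure hG hdecay).smul_mem c hv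

theorem isClosed_multiplierAlgebra :
    IsClosed (multiplierAlgebra hG hdecay : Set C(OnePoint ℝ, ℂ)) := by
  have : (multiplierAlgebra hG hdecay : Set C(OnePoint ℝ, ℂ)) =
      ⋂ v ∈ polyClosure hG hdecay,
        {g | restrictLine g * v ∈ polyClosure hG hdecay} := by
    ext g
    simp only [mem_iInter]
    exact Iff.rfl
  rw [this]
  refine isClosed_biInter fun v _ => (isClosed_polyClosure hG hdecay).preimage ?_
  exact continuous_restrictLine.mul continuous_const

theorem tendsto_inv_ofReal_sub_I :
    Tendsto (fun t : ℝ => ((t : ℂ) - Complex.I)⁻¹) (cocompact ℝ) (𝓝 0) := by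
  rw [tendsto_zero_iff_norm_tendsto_zero]
  simp only [norm_inv]
  refine tendsto_inv_atTop_zero.comp (tendsto_atTop_mono (fun t => ?_)
    (tendsto_norm_cocompact_atTop (E := ℝ)))
  simpa using Complex.abs_re_le_norm ((t : ℂ) - Complex.I)

/-- The function `t ↦ (t - i)⁻¹` on the compactified line. -/
noncomputable def resolventOnePoint : C(OnePoint ℝ, ℂ) :=
  OnePoint.continuousMapMk ⟨_, continuous_inv_ofReal_sub_I⟩ 0
    (by rw [coclosedCompact_eq_cocompact]; exact tendsto_inv_ofReal_sub_I)

theorem resolventOnePoint_injective : Function.Injective resolventOnePoint := by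
  have hcoe : ∀ t : ℝ, resolventOnePoint t = ((t : ℂ) - Complex.I)⁻¹ := fun t => rfl
  have hinf : resolventOnePoint OnePoint.infty = 0 := rfl
  intro x y hxy
  induction x using OnePoint.rec with
  | infty =>
    induction y using OnePoint.rec with
    | infty => rfl
    | coe t =>
      rw [hcoe, hinf] at hxy
      exact absurd hxy.symm (inv_ne_zero (ofReal_sub_I_ne_zero t))
  | coe s =>
    induction y using OnePoint.rec with
    | infty =>
      rw [hcoe, hinf] at hxy
      exact absurd hxy (inv_ne_zero (ofReal_sub_I_ne_zero s))
    | coe t =>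
      rw [hcoe, hcoe, inv_inj, sub_left_inj] at hxy
      rw [Complex.ofReal_injective hxy]

/-- The multipliers form a closed algebra containing `(t - i)⁻¹` and, because `G` is real, its
conjugate. The star algebra generated by `(t - i)⁻¹` separates the points of the compactified line,
so it is dense. -/
theorem multiplierAlgebra_eq_top
    (h : resolvent Complex.I * weightedPoly hG hdecay 1 ∈ polyClosure hG hdecay) :
    multiplierAlgebra hG hdecay = ⊤ := by
  have h' : resolvent (-Complex.I) * weightedPoly hG hdecay 1 ∈ polyClosure hG hdecay := by
    have := star_mem_polyClosure hG hdecay h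
    rwa [star_mul, star_weightedPoly, star_resolvent_I, Polynomial.map_one, mul_comm] at this
  have hu : restrictLine resolventOnePoint = resolvent Complex.I := by
    ext t
    rw [resolvent_apply (by simp)]; rfl
  have hu' : restrictLine (star resolventOnePoint) = resolvent (-Complex.I) := by
    rw [← star_resolvent_I, ← hu]; rfl
  set A := StarAlgebra.adjoin ℂ {resolventOnePoint} with hA
  have hsep : A.SeparatesPoints := fun x y hxy =>
    ⟨_, ⟨resolventOnePoint, StarAlgebra.self_mem_adjoin_singleton ℂ _, rfl⟩,
      fun he => hxy (resolventOnePoint_injective he)⟩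
  have hle : A.toSubalgebra ≤ multiplierAlgebra hG hdecay := by
    rw [hA, StarAlgebra.adjoin_toSubalgebra]
    refine Algebra.adjoin_le ?_
    rintro g (hg | hg)
    · rw [mem_singleton_iff.1 hg]
      intro v hv
      rw [hu]
      exact resolvent_mul_mem_polyClosure hG hdecay (by simp) h hv
    · rw [← star_star g, mem_singleton_iff.1 (Set.mem_star.1 hg)]
      intro v hv
      rw [hu']
      exact resolvent_mul_mem_polyClosure hG hdecay (by simp) h' hv
  refine top_unique fun g _ => ?_
  have hg : g ∈ A.topologicalClosure := by
    rw [ContinuousMap.starSubalgebra_topologicalClosure_eq_top_of_separatesPoints A hsep]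
    trivial
  exact closure_minimal hle (isClosed_multiplierAlgebra hG hdecay) hg

theorem exists_hasCompactSupport_norm_sub_le {f : ℝ → ℂ} (hf : f ∈ C0 G) {ε : ℝ} (hε : 0 < ε) :
    ∃ g : ℝ → ℂ, Continuous g ∧ HasCompactSupport g ∧ ∀ x, ‖(G x : ℂ) * (f x - g x)‖ ≤ ε := by
  have hev := hf.2.norm.eventually (gt_mem_nhds (by simpa using hε))
  obtain ⟨K, hK, hKε⟩ := Filter.mem_cocompact.1 hev
  obtain ⟨χ, hχ1, -, hχc, hχ⟩ := exists_continuous_one_zero_of_isCompact hK isClosed_empty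
    (disjoint_empty K)
  refine ⟨fun x => (χ x : ℂ) * f x, by have := hf.1; fun_prop, ?_, fun x => ?_⟩
  · have : HasCompactSupport fun x => (χ x : ℂ) :=
      hχc.comp_left (g := ((↑) : ℝ → ℂ)) Complex.ofReal_zero
    exact this.mul_right
  · by_cases hx : x ∈ K
    · have : χ x = 1 := hχ1 hx
      simp [this, hε.le]
    · have h1 : ‖(G x : ℂ) * f x‖ < ε := hKε hx
      have h2 : (G x : ℂ) * (f x - (χ x : ℂ) * f x) = ((1 - χ x : ℝ) : ℂ) * ((G x : ℂ) * f x) := by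
        push_cast; ring
      rw [h2, norm_mul, Complex.norm_real, Real.norm_of_nonneg (by linarith [(hχ x).2])]
      exact (mul_le_of_le_one_left (norm_nonneg _) (by linarith [(hχ x).1])).trans h1.le

/-- Cut `f` off to compact support. The truncation extends continuously by `0` at infinity, so it is
a multiplier and sends `G · 1` into the closure. -/
theorem exists_poly_norm_sub_le
    (h : resolvent Complex.I * weightedPoly hG hdecay 1 ∈ polyClosure hG hdecay) {f : ℝ → ℂ}
    (hf : f ∈ C0 G) {ε : ℝ} (hε : 0 < ε) :
    ∃ p : ℂ[X], ∀ x : ℝ, ‖(G x : ℂ) * (f x - p.eval (x : ℂ))‖ ≤ ε := by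
  obtain ⟨g, hgc, hgs, hg⟩ := exists_hasCompactSupport_norm_sub_le hf (half_pos hε)
  let γ : C(OnePoint ℝ, ℂ) := OnePoint.continuousMapMk ⟨g, hgc⟩ 0 (by
    rw [coclosedCompact_eq_cocompact]
    exact hgs.is_zero_at_infty)
  have hγ : γ ∈ multiplierAlgebra hG hdecay := by
    rw [multiplierAlgebra_eq_top hG hdecay h]; trivial
  have hmem : restrictLine γ * weightedPoly hG hdecay 1 ∈
      closure (LinearMap.range (weightedPoly hG hdecay) : Set (ℝ →ᵇ ℂ)) :=
    hγ _ (weightedPoly_mem_polyClosure hG hdecay 1)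
  obtain ⟨_, ⟨p, rfl⟩, hp⟩ := Metric.mem_closure_iff.1 hmem (ε / 2) (half_pos hε)
  refine ⟨p, fun x => ?_⟩
  have h1 := (BoundedContinuousFunction.dist_coe_le_dist x).trans hp.le
  have h2 : restrictLine γ x = g x := rfl
  rw [BoundedContinuousFunction.coe_mul, Pi.mul_apply, weightedPoly_apply, weightedPoly_apply,
    Polynomial.eval_one, mul_one, h2, dist_eq_norm] at h1
  calc ‖(G x : ℂ) * (f x - p.eval (x : ℂ))‖
      = ‖(G x : ℂ) * (f x - g x) + (g x * (G x : ℂ) - (G x : ℂ) * p.eval (x : ℂ))‖ := by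
        congr 1; ring
    _ ≤ ε / 2 + ε / 2 := (norm_add_le _ _).trans (add_le_add (hg x) h1)
    _ = ε := add_halves ε

end

/-! ### Regular tails have nearly extremal monomials -/

/-- The exponent of a weight with regular tail, extended by `0` to `(-∞, c]`. -/
noncomputable def tailExponent (c : ℝ) (w : ℝ → ℝ) (r : ℝ) : ℝ := ∫ t in c..max c r, w t / t

section

variable {c : ℝ} {w : ℝ → ℝ}

theorem intervalIntegrable_div (hc : 0 < c) (hw : MonotoneOn w (Ici c)) {a b : ℝ} (ha : c ≤ a)
    (hb : c ≤ b) : IntervalIntegrable (fun t => w t / t) volume a b := by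
  have hsub : uIcc a b ⊆ Ici c := fun t ht => (le_min ha hb).trans ht.1
  have h1 : IntervalIntegrable w volume a b := (hw.mono hsub).intervalIntegrable
  simp only [div_eq_mul_inv]
  refine h1.mul_continuousOn (continuousOn_inv₀.mono fun t ht => ?_)
  exact (hc.trans_le (hsub ht)).ne'

theorem tailExponent_of_le {r : ℝ} (hr : c ≤ r) : tailExponent c w r = ∫ t in c..r, w t / t := by
  rw [tailExponent, max_eq_right hr]

theorem tailExponent_of_ge {r : ℝ} (hr : r ≤ c) : tailExponent c w r = 0 := by
  rw [tailExponent, max_eq_left hr, intervalIntegral.integral_same]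

theorem tailExponent_sub (hc : 0 < c) (hw : MonotoneOn w (Ici c)) {s t : ℝ} (hs : c ≤ s)
    (ht : c ≤ t) : tailExponent c w t - tailExponent c w s = ∫ u in s..t, w u / u := by
  rw [tailExponent_of_le hs, tailExponent_of_le ht,
    intervalIntegral.integral_interval_sub_left (intervalIntegrable_div hc hw le_rfl ht)
      (intervalIntegrable_div hc hw le_rfl hs)]

theorem monotone_tailExponent (hc : 0 < c) (hpos : ∀ t, c ≤ t → 0 < w t)
    (hw : MonotoneOn w (Ici c)) : Monotone (tailExponent c w) := by
  intro s t hst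
  have h := tailExponent_sub hc hw (le_max_left c s) (le_max_left c t)
  have h0 : 0 ≤ ∫ u in max c s..max c t, w u / u := by
    refine intervalIntegral.integral_nonneg (max_le_max_left c hst) fun u hu => ?_
    have hcu : c ≤ u := (le_max_left _ _).trans hu.1
    exact div_nonneg (hpos u hcu).le (hc.le.trans hcu)
  have e : ∀ r, tailExponent c w (max c r) = tailExponent c w r := fun r => by
    simp [tailExponent]
  rw [e, e] at h
  linarith

theorem tailExponent_nonneg (hc : 0 < c) (hpos : ∀ t, c ≤ t → 0 < w t)
    (hw : MonotoneOn w (Ici c)) (r : ℝ) : 0 ≤ tailExponent c w r := by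
  rcases le_total r c with h | h
  · rw [tailExponent_of_ge h]
  · rw [← tailExponent_of_ge (w := w) le_rfl]
    exact monotone_tailExponent hc hpos hw h

theorem mul_log_div_le_integral (hc : 0 < c) (hw : MonotoneOn w (Ici c)) {s t a : ℝ}
    (hs : c ≤ s) (hst : s ≤ t) (ha : a ≤ w s) :
    a * Real.log (t / s) ≤ ∫ u in s..t, w u / u := by
  have hs0 := hc.trans_le hs
  rw [← integral_inv_of_pos hs0 (hs0.trans_le hst), ← intervalIntegral.integral_const_mul]
  refine intervalIntegral.integral_mono_on hst ?_
    (intervalIntegrable_div hc hw hs (hs.trans hst)) fun u hu => ?_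
  · refine (intervalIntegral.intervalIntegrable_inv (fun u hu => ?_) continuousOn_id).const_mul a
    rw [uIcc_of_le hst] at hu
    exact (hs0.trans_le hu.1).ne'
  · rw [div_eq_mul_inv]
    exact mul_le_mul_of_nonneg_right (ha.trans (hw hs (hs.trans hu.1) hu.1))
      (inv_nonneg.2 (hs0.le.trans hu.1))

theorem integral_le_mul_log_div (hc : 0 < c) (hw : MonotoneOn w (Ici c)) {s t a : ℝ}
    (hs : c ≤ s) (hst : s ≤ t) (ha : w t ≤ a) :
    ∫ u in s..t, w u / u ≤ a * Real.log (t / s) := by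
  have hs0 := hc.trans_le hs
  rw [← integral_inv_of_pos hs0 (hs0.trans_le hst), ← intervalIntegral.integral_const_mul]
  refine intervalIntegral.integral_mono_on hst
    (intervalIntegrable_div hc hw hs (hs.trans hst)) ?_ fun u hu => ?_
  · refine (intervalIntegral.intervalIntegrable_inv (fun u hu => ?_) continuousOn_id).const_mul a
    rw [uIcc_of_le hst] at hu
    exact (hs0.trans_le hu.1).ne'
  · rw [div_eq_mul_inv]
    exact mul_le_mul_of_nonneg_right ((hw (hs.trans hu.1) (hs.trans hst) hu.2).trans ha)
      (inv_nonneg.2 (hs0.le.trans hu.1))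

theorem continuous_tailExponent (hc : 0 < c) (hw : MonotoneOn w (Ici c)) :
    Continuous (tailExponent c w) := by
  have hint : ∀ a b, IntervalIntegrable (fun t => w (max c t) / max c t) volume a b := by
    intro a b
    have h1 : Monotone fun t => w (max c t) := fun s t hst =>
      hw (mem_Ici.2 (le_max_left c s)) (mem_Ici.2 (le_max_left c t)) (max_le_max_left c hst)
    simp only [div_eq_mul_inv]
    refine h1.intervalIntegrable.mul_continuousOn ?_
    exact ((by fun_prop : Continuous fun t : ℝ => max c t).inv₀
      fun t => (lt_max_of_lt_left hc).ne').continuousOn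
  have heq : tailExponent c w = fun r => ∫ t in c..max c r, w (max c t) / max c t := by
    ext r
    refine intervalIntegral.integral_congr fun t ht => ?_
    rw [uIcc_of_le (le_max_left _ _)] at ht
    simp only [max_eq_right ht.1]
  rw [heq]
  exact (intervalIntegral.continuous_primitive hint c).comp (by fun_prop)

/-- The logarithmic slope of `t ^ n exp(-k(t))` is `n - w(t)`, which is decreasing in the weak sense
on `[c, ∞)`. With `n = ⌊w r⌋₊` it is nonpositive beyond `r`, and between `c` and `r` it is at least
`-1`, costing a factor at most `r / c`. -/
theorem hasExtremalMonomials_tailExponent (hc : 0 < c) (hpos : ∀ t, c ≤ t → 0 < w t)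
    (hw : MonotoneOn w (Ici c)) : HasExtremalMonomials (tailExponent c w) := by
  set k := tailExponent c w with hk
  have hk0 := tailExponent_nonneg hc hpos hw
  refine ⟨1 + 1 / c, by positivity, fun r hr => ?_⟩
  rcases le_total r c with hrc | hrc
  · refine ⟨0, fun t _ => ?_⟩
    rw [hk, tailExponent_of_ge hrc]
    simp only [pow_zero, mul_one, neg_zero, Real.exp_zero]
    have h1 : Real.exp (-tailExponent c w t) ≤ 1 := Real.exp_le_one_iff.2 (by linarith [hk0 t])
    have h2 : 0 ≤ 1 / c := by positivity
    nlinarith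
  · have hr0 := hc.trans_le hrc
    refine ⟨⌊w r⌋₊, fun t ht => ?_⟩
    set n := ⌊w r⌋₊ with hn
    have hn1 : (n : ℝ) ≤ w r := Nat.floor_le (hpos r hrc).le
    have hn2 : w r ≤ n + 1 := (Nat.lt_floor_add_one _).le
    have hbase : ∀ t, c ≤ t → Real.exp (-k t) * t ^ n ≤
        (1 + r / c) * (Real.exp (-k r) * r ^ n) := by
      intro t hct
      have ht0 := hc.trans_le hct
      have hE : 0 ≤ Real.exp (-k r) * r ^ n := by positivity
      rcases le_total r t with hrt | hrt
      · have h1 := mul_log_div_le_integral hc hw hrc hrt hn1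
        rw [← tailExponent_sub hc hw hrc hct, ← Real.log_pow] at h1
        have h2 : Real.exp (-k t) * (t / r) ^ n ≤ Real.exp (-k r) := by
          rw [← Real.exp_log (show 0 < (t / r) ^ n by positivity), ← Real.exp_add]
          exact Real.exp_le_exp.2 (by linarith)
        have h3 : Real.exp (-k t) * t ^ n ≤ Real.exp (-k r) * r ^ n := by
          rw [div_pow, ← mul_div_assoc, div_le_iff₀ (by positivity)] at h2
          exact h2
        have h4 : 0 ≤ r / c := by positivity
        nlinarith
      · have h1 := integral_le_mul_log_div hc hw hct hrt hn2
        rw [← tailExponent_sub hc hw hct hrc] at h1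
        have h1' : k r - k t ≤ Real.log ((r / t) ^ (n + 1)) := by
          rw [Real.log_pow]; exact_mod_cast h1
        have h2 : Real.exp (-k t) ≤ Real.exp (-k r) * (r / t) ^ (n + 1) := by
          rw [← Real.exp_log (show 0 < (r / t) ^ (n + 1) by positivity), ← Real.exp_add]
          exact Real.exp_le_exp.2 (by linarith)
        calc Real.exp (-k t) * t ^ n ≤ Real.exp (-k r) * (r / t) ^ (n + 1) * t ^ n := by gcongr
          _ = r / t * (Real.exp (-k r) * r ^ n) := by
            rw [pow_succ, div_pow]; field_simp
          _ ≤ (1 + r / c) * (Real.exp (-k r) * r ^ n) := by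
            gcongr
            have : r / t ≤ r / c := by gcongr
            linarith
    have hfin : Real.exp (-k t) * t ^ n ≤ (1 + r / c) * (Real.exp (-k r) * r ^ n) := by
      rcases le_total c t with hct | hct
      · exact hbase t hct
      -- Below `c` the exponent vanishes, so the comparison reduces to `t ^ n ≤ c ^ n`.
      · refine le_trans ?_ (hbase c le_rfl)
        rw [hk, tailExponent_of_ge hct, tailExponent_of_ge le_rfl]
        gcongr
    refine hfin.trans ?_
    rw [mul_assoc]
    refine mul_le_mul_of_nonneg_right ?_ (by positivity)
    have h1 : 0 ≤ 1 / c := by positivity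
    have h2 : r / c = 1 / c * r := by ring
    nlinarith

end

/-! ### Density for regular weights -/

theorem C0Norm_le_of_forall {W : ℝ → ℝ} (hW : ∀ x, 0 ≤ W x) {f : ℝ → ℂ} {ε : ℝ}
    (h : ∀ x, W x * ‖f x‖ ≤ ε) : C0Norm W f ≤ ENNReal.ofReal ε := by
  refine iSup_le fun x => ?_
  rw [← ofReal_norm, ← ENNReal.ofReal_mul (hW x)]
  exact ENNReal.ofReal_le_ofReal (h x)

theorem eval_mem_C0_and_C0Norm_lt_top {W : ℝ → ℝ} (hW : ∀ x, 0 ≤ W x)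
    (hbdd : ∃ M, ∀ x, W x ≤ M) (hdecay : RapidlyDecaying W) (p : ℂ[X]) :
    (fun x : ℝ => p.eval (x : ℂ)) ∈ C0 W ∧ C0Norm W (fun x : ℝ => p.eval (x : ℂ)) < ⊤ := by
  have hlim := hdecay.tendsto_mul_eval p
  refine ⟨⟨by fun_prop, hlim⟩, ?_⟩
  obtain ⟨M, hM⟩ := hbdd
  have hM0 : 0 ≤ M := (hW 0).trans (hM 0)
  obtain ⟨K, hK, hK1⟩ := Filter.mem_cocompact.1
    (hlim.norm.eventually (gt_mem_nhds (by simp : ‖(0 : ℂ)‖ < 1)))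
  obtain ⟨D, hD⟩ := hK.exists_bound_of_continuousOn
    (f := fun x : ℝ => p.eval (x : ℂ)) (by fun_prop)
  refine (C0Norm_le_of_forall hW (ε := M * |D| + 1) fun x => ?_).trans_lt ENNReal.ofReal_lt_top
  by_cases hx : x ∈ K
  · have := mul_le_mul (hM x) ((hD x hx).trans (le_abs_self D)) (norm_nonneg _) hM0
    linarith
  · have h1 : ‖(W x : ℂ) * p.eval (x : ℂ)‖ < 1 := hK1 hx
    rw [norm_mul, Complex.norm_real, Real.norm_of_nonneg (hW x)] at h1
    have : 0 ≤ M * |D| := by positivity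
    linarith

theorem neg_log_ofReal_toENNReal {y : ℝ} (hy : 0 < y) :
    (-ENNReal.log (ENNReal.ofReal y)).toENNReal = ENNReal.ofReal (-Real.log y) := by
  rw [ENNReal.log_ofReal_of_pos hy, ← EReal.coe_neg, EReal.toENNReal_of_ne_top (EReal.coe_ne_top _),
    EReal.toReal_coe]

theorem log_ofReal_toENNReal {y : ℝ} (hy : 0 < y) :
    (ENNReal.log (ENNReal.ofReal y)).toENNReal = ENNReal.ofReal (Real.log y) := by
  rw [ENNReal.log_ofReal_of_pos hy, EReal.toENNReal_of_ne_top (EReal.coe_ne_top _),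
    EReal.toReal_coe]

/-- The model weight `exp(-k(|x|))` equals `W` for `|x| ≥ c` and dominates it up to a constant
everywhere, so approximation for the model suffices. -/
theorem polynomialsDense_of_logIntegralEqBot {W : ℝ → ℝ} (hW : IsRegularWeight W)
    (hbot : LogIntegralEqBot W) : PolynomialsDense W := by
  refine ⟨eval_mem_C0_and_C0Norm_lt_top hW.nonneg hW.bounded hW.rapidlyDecaying,
    fun f hf => ?_⟩
  obtain ⟨c, w, hc, hpos, hmono, -, htail⟩ := hW.regularTail
  set k := tailExponent c w with hk
  have hkc := continuous_tailExponent hc hmono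
  have hEW : ∀ x, c ≤ |x| → expWeight k x = W x := fun x hx => by
    rw [htail x hx, expWeight, hk, tailExponent_of_le hx]
  have hev : ∀ᶠ x in cocompact ℝ, expWeight k x = W x :=
    ((tendsto_norm_cocompact_atTop (E := ℝ)).eventually_ge_atTop c).mono fun x hx => hEW x hx
  have hdecay : RapidlyDecaying (expWeight k) := fun n =>
    (hW.rapidlyDecaying n).congr' (hev.mono fun x hx => by simp only [hx])
  obtain ⟨M, hM⟩ := hW.bounded
  set M' := max M 1
  have hM' : 0 < M' := lt_max_of_lt_right one_pos
  have hle : ∀ x, W x ≤ M' * expWeight k x := by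
    intro x
    rcases le_total c |x| with hx | hx
    · rw [hEW x hx]
      exact le_mul_of_one_le_left (hW.nonneg x) (le_max_right _ _)
    · rw [expWeight, hk, tailExponent_of_ge hx, neg_zero, Real.exp_zero, mul_one]
      exact (hM x).trans (le_max_left _ _)
  -- Local integrability of `log W` makes the contribution of `[-c, c]` finite, so the divergence
  -- comes from the tail, where `-log W = k(|x|)`.
  have hdiv : ∫⁻ x, ENNReal.ofReal (k |x|) ∂poissonMeasure = ⊤ := by
    by_contra hfin
    have hloc : ∫⁻ x in Icc (-c) c, ENNReal.ofReal (-Real.log (W x)) < ⊤ :=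
      (hW.log_locallyIntegrable.integrableOn_isCompact isCompact_Icc).neg.lintegral_lt_top
    have hlogm : Measurable fun x => ENNReal.ofReal (-Real.log (W x)) :=
      (Real.measurable_log.comp hW.measurable).neg.ennreal_ofReal
    refine hbot.2.not_lt ?_
    have hae : ∀ᵐ x ∂poissonMeasure, (-ENNReal.log (ENNReal.ofReal (W x))).toENNReal ≤
        (Icc (-c) c).indicator (fun x => ENNReal.ofReal (-Real.log (W x))) x +
          ENNReal.ofReal (k |x|) := by
      refine poissonMeasure_absolutelyContinuous.ae_le ?_
      filter_upwards [hW.ae_pos] with x hx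
      rw [neg_log_ofReal_toENNReal hx]
      rcases le_total c |x| with hcx | hcx
      · rw [← hEW x hcx, expWeight, Real.log_exp, neg_neg]
        exact le_add_left le_rfl
      · rw [indicator_of_mem (mem_Icc.2 (abs_le.1 hcx))]
        exact le_add_right le_rfl
    refine (lintegral_mono_ae hae).trans_lt ?_
    rw [lintegral_add_left (hlogm.indicator measurableSet_Icc),
      lintegral_poissonMeasure (hlogm.indicator measurableSet_Icc).aemeasurable]
    refine ENNReal.add_lt_top.2 ⟨?_, lt_top_iff_ne_top.2 hfin⟩
    refine lt_of_le_of_lt (lintegral_mono fun x => ?_)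
      ((lintegral_indicator measurableSet_Icc _).trans_lt hloc)
    refine mul_le_of_le_one_left' ?_
    rw [ENNReal.ofReal_le_one]
    exact inv_le_one_of_one_le₀ (by nlinarith [sq_nonneg x])
  have hmem := resolvent_I_mul_mem_polyClosure hkc (monotone_tailExponent hc hpos hmono)
    (tailExponent_nonneg hc hpos hmono) (hasExtremalMonomials_tailExponent hc hpos hmono)
    hdecay hdiv
  have hf' : f ∈ C0 (expWeight k) :=
    ⟨hf.1, hf.2.congr' (hev.mono fun x hx => by simp only [hx])⟩
  refine le_antisymm (ENNReal.le_of_forall_pos_le_add fun ε hε _ => ?_) bot_le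
  obtain ⟨p, hp⟩ := exists_poly_norm_sub_le (continuous_expWeight hkc) hdecay hmem hf'
    (ε := ε / M') (by positivity)
  refine (iInf_le _ p).trans ?_
  rw [zero_add, ← ENNReal.ofReal_coe_nnreal]
  refine C0Norm_le_of_forall hW.nonneg fun x => ?_
  have h1 := hp x
  rw [norm_mul, Complex.norm_real, expWeight, Real.norm_of_nonneg (Real.exp_pos _).le] at h1
  calc W x * ‖f x - p.eval (x : ℂ)‖ ≤ M' * expWeight k x * ‖f x - p.eval (x : ℂ)‖ := by
        gcongr; exact hle x
    _ = M' * (expWeight k x * ‖f x - p.eval (x : ℂ)‖) := mul_assoc _ _ _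
    _ ≤ M' * (ε / M') := mul_le_mul_of_nonneg_left h1 hM'.le
    _ = ε := by field_simp

/-! ### Density excludes annihilating measures -/

/-- The pairing is taken over `ℝ`, so a complex scalar has to be moved out through commutativity of
multiplication. -/
theorem vectorIntegral_const_mul {μ : ComplexMeasure ℝ} (a : ℂ) (f : ℝ → ℂ) :
    VectorMeasure.integral μ (fun x => a * f x) (ContinuousLinearMap.mul ℝ ℂ) =
      a * VectorMeasure.integral μ f (ContinuousLinearMap.mul ℝ ℂ) := by
  simp only [VectorMeasure.integral_eq_setToFun, ← smul_eq_mul a]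
  refine setToFun_smul _ (fun b s x => ?_) a f
  simp [VectorMeasure.transpose, mul_left_comm]

theorem MomentsVanish.integrable_eval {μ : ComplexMeasure ℝ} (hμ : MomentsVanish μ) (p : ℂ[X]) :
    μ.Integrable fun x : ℝ => p.eval (x : ℂ) := by
  simp only [Polynomial.eval_eq_sum_range]
  exact integrable_finsetSum _ fun n _ => (hμ n).1.const_mul _

theorem MomentsVanish.integral_eval {μ : ComplexMeasure ℝ} (hμ : MomentsVanish μ) (p : ℂ[X]) :
    VectorMeasure.integral μ (fun x : ℝ => p.eval (x : ℂ)) (ContinuousLinearMap.mul ℝ ℂ) = 0 := by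
  simp only [Polynomial.eval_eq_sum_range]
  rw [VectorMeasure.integral_finsetSum _ fun n _ => (hμ n).1.const_mul _]
  refine Finset.sum_eq_zero fun n _ => ?_
  rw [vectorIntegral_const_mul, (hμ n).2, mul_zero]

theorem enorm_vectorIntegral_le {μ : ComplexMeasure ℝ} (f : ℝ → ℂ) :
    ‖VectorMeasure.integral μ f (ContinuousLinearMap.mul ℝ ℂ)‖ₑ ≤ ∫⁻ x, ‖f x‖ₑ ∂μ.variation := by
  refine VectorMeasure.enorm_integral_le_lintegral_enorm.trans ?_
  refine mul_le_of_le_one_left' ?_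
  rw [← ofReal_norm, ENNReal.ofReal_le_one]
  exact ContinuousLinearMap.opNorm_mul_le ℝ ℂ

/-- For every polynomial `p`, `|∫ f dμ| = |∫ (f - p) dμ| ≤ ‖f - p‖ ∫ W⁻¹ d|μ|`, and the right side
can be made arbitrarily small. -/
theorem integral_eq_zero_of_hasCompactSupport {W : ℝ → ℝ} (hm : Measurable W)
    (hdense : PolynomialsDense W) {μ : ComplexMeasure ℝ} [IsFiniteMeasure μ.variation]
    (hμ : MemM W μ) (hmom : MomentsVanish μ) {f : ℝ → ℂ} (hf : Continuous f)
    (hfc : HasCompactSupport f) :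
    VectorMeasure.integral μ f (ContinuousLinearMap.mul ℝ ℂ) = 0 := by
  have hf0 : f ∈ C0 W := by
    refine ⟨hf, ?_⟩
    have hs : HasCompactSupport fun x => (W x : ℂ) * f x := hfc.mul_left
    exact hs.is_zero_at_infty
  have hfi : μ.Integrable f := hf.integrable_of_hasCompactSupport hfc
  have hpos : ∀ᵐ x ∂μ.variation, 0 < W x := by
    filter_upwards [ae_lt_top hm.ennreal_ofReal.inv hμ.ne] with x hx
    exact ENNReal.ofReal_pos.1 (ENNReal.inv_lt_top.1 hx)
  set A := ∫⁻ x, (ENNReal.ofReal (W x))⁻¹ ∂μ.variation with hA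
  -- Dividing by `A + 1` instead of `A` covers the case `A = 0`.
  have hA1 : A + 1 ≠ ⊤ := ENNReal.add_ne_top.2 ⟨hμ.ne, ENNReal.one_ne_top⟩
  rw [← enorm_eq_zero, ← nonpos_iff_eq_zero]
  refine ENNReal.le_of_forall_pos_le_add fun δ hδ _ => ?_
  obtain ⟨p, hp⟩ := exists_C0Norm_lt_of_polynomialsDense hdense hf0 (ε := δ / (A + 1))
    (ENNReal.div_pos (by simpa using hδ.ne') hA1)
  have h1 : VectorMeasure.integral μ f (ContinuousLinearMap.mul ℝ ℂ) =
      VectorMeasure.integral μ (fun x : ℝ => f x - p.eval (x : ℂ))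
        (ContinuousLinearMap.mul ℝ ℂ) := by
    rw [VectorMeasure.integral_fun_sub hfi (hmom.integrable_eval p), hmom.integral_eval, sub_zero]
  rw [h1, zero_add]
  calc _ ≤ ∫⁻ x : ℝ, ‖f x - p.eval (x : ℂ)‖ₑ ∂μ.variation := enorm_vectorIntegral_le _
    _ ≤ ∫⁻ x, δ / (A + 1) * (ENNReal.ofReal (W x))⁻¹ ∂μ.variation := by
      refine lintegral_mono_ae ?_
      filter_upwards [hpos] with x hx
      have hx0 : ENNReal.ofReal (W x) ≠ 0 := by simpa using hx
      have h2 : ENNReal.ofReal (W x) * ‖f x - p.eval (x : ℂ)‖ₑ ≤ δ / (A + 1) :=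
        (le_iSup (fun x : ℝ => ENNReal.ofReal (W x) * ‖f x - p.eval (x : ℂ)‖ₑ) x).trans hp.le
      rw [← div_eq_mul_inv, ENNReal.le_div_iff_mul_le (Or.inl hx0) (Or.inl ENNReal.ofReal_ne_top),
        mul_comm]
      exact h2
    _ = δ / (A + 1) * A := lintegral_const_mul _ hm.ennreal_ofReal.inv
    _ ≤ δ / (A + 1) * (A + 1) := by gcongr; exact le_self_add
    _ = δ := ENNReal.div_mul_cancel (by simp) hA1

theorem isFiniteMeasure_variation_of_memM {W : ℝ → ℝ} (hbdd : ∃ M, ∀ x, W x ≤ M)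
    {μ : ComplexMeasure ℝ} (hμ : MemM W μ) : IsFiniteMeasure μ.variation := by
  obtain ⟨M, hM⟩ := hbdd
  have h : ∫⁻ _, (ENNReal.ofReal (max M 1))⁻¹ ∂μ.variation < ⊤ := by
    refine (lintegral_mono fun x => ?_).trans_lt hμ
    exact ENNReal.inv_le_inv.2 (ENNReal.ofReal_le_ofReal ((hM x).trans (le_max_left _ _)))
  rw [lintegral_const, ENNReal.mul_lt_top_iff] at h
  refine ⟨?_⟩
  rcases h with h | h | h
  · exact h.2
  · exact absurd h (ENNReal.inv_ne_zero.2 ENNReal.ofReal_ne_top)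
  · rw [h]; exact ENNReal.zero_lt_top

/-- Boundedness of `W` makes `|μ|` finite, so indicators are `L¹(|μ|)`-limits of compactly supported
continuous functions, whose integrals vanish. -/
theorem eq_zero_of_polynomialsDense {W : ℝ → ℝ} (hm : Measurable W)
    (hbdd : ∃ M, ∀ x, W x ≤ M) (hdense : PolynomialsDense W) {μ : ComplexMeasure ℝ}
    (hμ : MemM W μ) (hmom : MomentsVanish μ) : μ = 0 := by
  have hfin := isFiniteMeasure_variation_of_memM hbdd hμ
  ext s hs
  have hind : μ.Integrable (s.indicator fun _ => (1 : ℂ)) :=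
    (integrable_const (1 : ℂ)).indicator hs
  rw [FunLike.coe_zero, Pi.zero_apply, ← enorm_eq_zero, ← nonpos_iff_eq_zero]
  refine ENNReal.le_of_forall_pos_le_add fun δ hδ _ => ?_
  obtain ⟨g, hgs, hg, hgc, hgi⟩ := hind.exists_hasCompactSupport_lintegral_sub_le
    (ε := δ) (by simpa using hδ.ne')
  have h1 : μ s = VectorMeasure.integral μ
      (fun x => s.indicator (fun _ => (1 : ℂ)) x - g x) (ContinuousLinearMap.mul ℝ ℂ) := by
    rw [VectorMeasure.integral_fun_sub hind hgi,
      integral_eq_zero_of_hasCompactSupport hm hdense hμ hmom hgc hgs,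
      VectorMeasure.integral_indicator_const _ hs]
    simp
  rw [h1, zero_add]
  exact (enorm_vectorIntegral_le _).trans hg

/-- Boundedness of `W` and finiteness of `P` make the positive part of `log W` integrable, so only
the negative part can diverge. -/
theorem logIntegrable_of_not_logIntegralEqBot {W : ℝ → ℝ} (hm : Measurable W)
    (hpos : ∀ᵐ x, 0 < W x) (hbdd : ∃ M, ∀ x, W x ≤ M) (h : ¬ LogIntegralEqBot W) :
    LogIntegrable W := by
  obtain ⟨M, hM⟩ := hbdd
  have hpos' : ∀ᵐ x ∂poissonMeasure, 0 < W x := poissonMeasure_absolutelyContinuous.ae_le hpos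
  have h1 : ∫⁻ x, (ENNReal.log (ENNReal.ofReal (W x))).toENNReal ∂poissonMeasure =
      ∫⁻ x, ENNReal.ofReal (Real.log (W x)) ∂poissonMeasure :=
    lintegral_congr_ae (hpos'.mono fun x hx => log_ofReal_toENNReal hx)
  have h2 : ∫⁻ x, (-ENNReal.log (ENNReal.ofReal (W x))).toENNReal ∂poissonMeasure =
      ∫⁻ x, ENNReal.ofReal (-Real.log (W x)) ∂poissonMeasure :=
    lintegral_congr_ae (hpos'.mono fun x hx => neg_log_ofReal_toENNReal hx)
  have h3 : ∫⁻ x, ENNReal.ofReal (Real.log (W x)) ∂poissonMeasure < ⊤ := by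
    refine (lintegral_mono_ae (g := fun _ => ENNReal.ofReal (Real.log M))
      (hpos'.mono fun x hx => ENNReal.ofReal_le_ofReal (Real.log_le_log hx (hM x)))).trans_lt ?_
    rw [lintegral_const]
    exact ENNReal.mul_lt_top ENNReal.ofReal_lt_top (measure_lt_top _ _)
  rw [LogIntegralEqBot, h1, h2, not_and] at h
  have hlm : Measurable fun x => Real.log (W x) := Real.measurable_log.comp hm
  refine ⟨hpos, hlm.aestronglyMeasurable, ?_⟩
  rw [HasFiniteIntegral]
  refine lt_of_le_of_lt (b := ∫⁻ x, (ENNReal.ofReal (Real.log (W x)) +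
    ENNReal.ofReal (-Real.log (W x))) ∂poissonMeasure) (lintegral_mono fun x => ?_) ?_
  · rw [← ofReal_norm, Real.norm_eq_abs]
    rcases le_total 0 (Real.log (W x)) with h0 | h0
    · rw [abs_of_nonneg h0]; exact le_self_add
    · rw [abs_of_nonpos h0]; exact le_add_self
  · rw [lintegral_add_left hlm.ennreal_ofReal]
    exact ENNReal.add_lt_top.2 ⟨h3, lt_top_iff_ne_top.2 (h h3)⟩

end Bernstein

theorem mainTheorem9 :
    (∀ W : ℝ → ℝ, Bernstein.IsRegularWeight W →
      (Bernstein.PolynomialsDense W ↔ Bernstein.LogIntegralEqBot W) ∧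
      ((∃ μ : MeasureTheory.ComplexMeasure ℝ,
          μ ≠ 0 ∧ Bernstein.MemM W μ ∧ Bernstein.MomentsVanish μ) ↔
        Bernstein.LogIntegrable W)) ∧
    (∀ W : ℝ → ℝ, Measurable W → (∀ x, 0 ≤ W x) →
      MeasureTheory.Integrable W MeasureTheory.volume → Bernstein.LogIntegrable W →
      (∃ μ : MeasureTheory.ComplexMeasure ℝ,
        μ ≠ 0 ∧ Bernstein.MemM W μ ∧ Bernstein.MomentsVanish μ) ∧
      ((∃ M : ℝ, ∀ x, W x ≤ M) → Bernstein.RapidlyDecaying W →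
        ¬ Bernstein.PolynomialsDense W)) := by
  refine ⟨fun W hW => ⟨⟨fun hdense => ?_, Bernstein.polynomialsDense_of_logIntegralEqBot hW⟩,
    ?_, Bernstein.exists_annihilating_of_logIntegrable hW.measurable hW.nonneg⟩,
    fun W hm hW _ hlog => ⟨Bernstein.exists_annihilating_of_logIntegrable hm hW hlog,
      fun _ => Bernstein.not_polynomialsDense hW hlog⟩⟩
  · by_contra hbot
    exact Bernstein.not_polynomialsDense hW.nonneg
      (Bernstein.logIntegrable_of_not_logIntegralEqBot hW.measurable hW.ae_pos hW.bounded hbot)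
      hW.rapidlyDecaying hdense
  · rintro ⟨μ, hμ0, hμ, hmom⟩
    by_contra hlog
    refine hμ0 (Bernstein.eq_zero_of_polynomialsDense hW.measurable hW.bounded
      (Bernstein.polynomialsDense_of_logIntegralEqBot hW ?_) hμ hmom)
    by_contra hbot
    exact hlog
      (Bernstein.logIntegrable_of_not_logIntegralEqBot hW.measurable hW.ae_pos hW.bounded hbot)
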